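/- Let $(\Gamma_n)_{n\in\mathbb N}$ be a sequence of finite groups with symmetric generating sets $S_n\subseteq\Gamma_n$ such that $\sup_n\#S_n<\infty$, let $l_n$ be the word length on $\Gamma_n$ with respect to $S_n$, and let $X=\bigsqcup_n\Gamma_n$ be the separated disjoint union, with $d(g,h)=l_n(g^{-1}h)$ for $g,h\in\Gamma_n$ and $d(g,h)=\infty$ if $g,h$ lie in different $\Gamma_n$. Let $\omega$ be a free ultrafilter on $\mathbb N$, and let $$\Gamma^\infty_\omega=\Big\{(\gamma_n)\in\prod_n\Gamma_n:\ \sup_n l_n(\gamma_n)<\infty\Big\}\Big/\Big\{(\gamma_n):\ \sup_n l_n(\gamma_n)<\infty,\ \lim_{n\to\omega}l_n(\gamma_n)=0\Big\}.$$ Let $Y$ be the Gelfand spectrum of $\ell^\infty(X)/\{f:\lim_{n\to\omega}\|f|_{\Gamma_n}\|_\infty=0\}$, and let $\mu$ be the regular Borel probability measure on $Y$ that represents the state $f\mapsto\lim_{n\to\omega}\frac1{\#\Gamma_n}\sum_{x\in\Gamma_n}f(x)$. Let $\mathfrak B$ be a uniformly convex complex Banach space and $p\in(1,\infty)$. (i)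 If $X$ has geometric property $(T_{L^p(\mu,\mathfrak B)})$, then $\Gamma^\infty_\omega$ has property $(T_{\mathfrak B})$. (ii) If $X$ has uniform geometric property $(T_{L^p(\mu,\mathfrak B)})$, then $\Gamma^\infty_\omega$ has uniform property $(T_{\mathfrak B})$. Here the following definitions are used. The algebra $\mathbb C_u[X]$ consists of the $X\times X$ complex matrices with uniformly bounded entries and finite propagation; $\ell^\infty(X)$ embeds in it as the diagonal matrices. A partial translation is a $0$-$1$ matrix $V\in\mathbb C_u[X]$ with at most one $1$ in every row and every column, and $\Phi(V)\in\ell^\infty(X)$ is the function of its row sums. An entourage is a subset of $\{(x,y):d(x,y)\le R\}$ for some $R<\infty$; it is generating if every entourage lies in a finite union of its iterated compositions (the $0$-fold one being the diagonal). A representation of $\mathbb C_u[X]$ on a Banach space $E$ is a unital algebra homomorphism $\pi:\mathbb C_u[X]\to\mathcal L(E)$ with $\|\pi(T)\|\le\|T\|_{\ell^1}$, where $\|T\|_{\ell^1}$ is the infimum of $\sum_i\|f_i\|_\infty$ over all finite decompositions $T=\sum_i f_iV_i$ with $f_i\in\ell^\infty(X)$ and $V_i$ partial translations. Put $E^\pi=\{\xi:\pi(V)\xi=\pi(\Phi(V))\xi\text{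 for all partial translations }V\}$. For an entourage $E_0$, the representation $\pi$ has spectral gap at least $c$ if every $\xi\in E$ with $\|[\xi]\|_{E/E^\pi}=1$ admits a partial translation $V$ supported in $E_0$ with $\|[\pi(V)\xi-\pi(\Phi(V))\xi]\|_{E/E^\pi}\ge c$. The space $X$ has geometric property $(T_E)$ if, for some symmetric generating entourage $E_0$, every representation on $E$ has spectral gap at least $c$ for some $c>0$; it has uniform geometric property $(T_E)$ if $c>0$ can be chosen independently of the representation. A finitely generated group $G$ has property $(T_{\mathfrak B})$ if, for every finite symmetric generating set $S$ and every homomorphism $\rho$ from $G$ to the group of invertible linear isometries of $\mathfrak B$, there is $c>0$ such that no $\xi\in\mathfrak B$ with $\|[\xi]\|_{\mathfrak B/\mathfrak B^\rho}=1$ satisfies $\|[\rho(g)\xi-\xi]\|_{\mathfrak B/\mathfrak B^\rho}\le c$ for all $g\in S$, where $\mathfrak B^\rho$ is the subspace of $\rho(G)$-invariant vectors; uniform property $(T_{\mathfrak B})$ means that, for every such $S$, the number $c>0$ can be chosen independently of $\rho$. Both properties include that $G$ is finitely generated. -/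

import Mathlib

open scoped ENNReal NNReal Topology
open MeasureTheory

noncomputable section

namespace CoarseT

universe u v

/-! ## Coarse geometry -/

/-- Bounded geometry: for every finite `R`, balls of radius `R` have uniformly bounded cardinality.
Extended metric spaces are `EMetricSpace`s, the distance may be `∞`. -/
class BoundedGeometry (X : Type u) [EMetricSpace X] : Prop where
  exists_bound : ∀ R : ℝ≥0, ∃ N : ℕ, ∀ x : X, {y : X | edist x y ≤ R}.encard ≤ N

/-- Entourages: the subsets of `X × X` contained in some `R`-diagonal. -/
def IsEntourage {X : Type u} [EMetricSpace X] (E : Set (X × X)) : Prop :=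
  ∃ R : ℝ≥0, ∀ p ∈ E, edist p.1 p.2 ≤ R

/-- The composition of two relations. -/
def compRel {X : Type u} (E F : Set (X × X)) : Set (X × X) :=
  {p | ∃ z, (p.1, z) ∈ E ∧ (z, p.2) ∈ F}

/-- The `n`-fold composition; the `0`-fold composition is the diagonal. -/
def powRel {X : Type u} (E : Set (X × X)) : ℕ → Set (X × X)
  | 0 => {p | p.1 = p.2}
  | n + 1 => compRel (powRel E n) E

/-- `E` is a symmetric entourage which generates the coarse structure of `X`: every entourage
is contained in a finite composition of `E ∪ diagonal`, i.e. in a finite union of compositions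
of `E`. -/
structure IsGenerating {X : Type u} [EMetricSpace X] (E : Set (X × X)) : Prop where
  isEntourage : IsEntourage E
  symm : ∀ x y, (x, y) ∈ E → (y, x) ∈ E
  generates : ∀ F : Set (X × X), IsEntourage F → ∃ n : ℕ, F ⊆ ⋃ k ≤ n, powRel E k

/-! ## The algebraic uniform Roe algebra -/

/-- The algebra `ℓ^∞(X)` of bounded complex functions, with the sup norm. -/
abbrev EllInfty (X : Type u) : Type u := lp (fun _ : X => ℂ) ∞

/-- The matrix entry `T_{xy}` of an operator on finitely supported functions. -/
def entry {X : Type u} (T : Module.End ℂ (X →₀ ℂ)) (x y : X) : ℂ := T (Finsupp.single y 1) x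

theorem entry_mul {X : Type u} (T S : Module.End ℂ (X →₀ ℂ)) (x y : X) :
    entry (T * S) x y = ∑ z ∈ (S (Finsupp.single y 1)).support, entry T x z * entry S z y := by
  have h : S (Finsupp.single y 1) = ∑ z ∈ (S (Finsupp.single y 1)).support,
      (S (Finsupp.single y 1) z) • Finsupp.single z (1 : ℂ) := by
    conv_lhs => rw [← Finsupp.sum_single (S (Finsupp.single y 1))]
    simp [Finsupp.sum]
  have h2 : entry (T * S) x y = T (S (Finsupp.single y 1)) x := rfl
  rw [h2]
  conv_lhs => rw [h]
  rw [map_sum, Finsupp.finsetSum_apply]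
  refine Finset.sum_congr rfl fun z _ => ?_
  rw [map_smul, Finsupp.smul_apply, smul_eq_mul, mul_comm]
  rfl

/-- The algebraic uniform Roe algebra `ℂ_u[X]`: all `X`-by-`X` complex matrices with uniformly
bounded entries and finite propagation. By bounded geometry such a matrix has finite columns, so
it is the matrix of a unique operator on finitely supported functions (see `ofMatrix`,
`entry_ofMatrix`, `uniformRoe_ext`), and the multiplication of matrices is the composition of
operators (see `entry_mul`). -/
def uniformRoe (X : Type u) [EMetricSpace X] [BoundedGeometry X] :
    Subalgebra ℂ (Module.End ℂ (X →₀ ℂ)) where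
  carrier := {T | (∃ C : ℝ, ∀ x y, ‖entry T x y‖ ≤ C) ∧
    ∃ R : ℝ≥0, ∀ x y, entry T x y ≠ 0 → edist x y ≤ R}
  add_mem' := by
    rintro T S ⟨⟨C, hC⟩, R, hR⟩ ⟨⟨C', hC'⟩, R', hR'⟩
    have hadd : ∀ x y, entry (T + S) x y = entry T x y + entry S x y := fun x y => rfl
    refine ⟨⟨C + C', fun x y => ?_⟩, max R R', fun x y h => ?_⟩
    · rw [hadd]
      exact (norm_add_le _ _).trans (add_le_add (hC x y) (hC' x y))
    · by_cases h1 : entry T x y = 0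
      · have h2 : entry S x y ≠ 0 := by
          intro h2
          exact h (by rw [hadd, h1, h2, add_zero])
        exact (hR' x y h2).trans (by exact_mod_cast le_max_right R R')
      · exact (hR x y h1).trans (by exact_mod_cast le_max_left R R')
  mul_mem' := by
    rintro T S ⟨⟨C, hC⟩, R, hR⟩ ⟨⟨C', hC'⟩, R', hR'⟩
    refine ⟨?_, R + R', fun x y h => ?_⟩
    · obtain ⟨N, hN⟩ := BoundedGeometry.exists_bound (X := X) R'
      refine ⟨N * (|C| * |C'|), fun x y => ?_⟩
      rw [entry_mul]
      have hcard : ((S (Finsupp.single y 1)).support.card : ℝ) ≤ N := by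
        have h1 : ((S (Finsupp.single y 1)).support : Set X) ⊆ {z | edist y z ≤ R'} := by
          intro z hz
          have : entry S z y ≠ 0 := by simpa [entry] using hz
          simpa [edist_comm] using hR' z y this
        have h2 := (Set.encard_le_encard h1).trans (hN y)
        rw [Set.encard_coe_eq_coe_finsetCard] at h2
        exact_mod_cast h2
      calc ‖∑ z ∈ (S (Finsupp.single y 1)).support, entry T x z * entry S z y‖
          ≤ ∑ z ∈ (S (Finsupp.single y 1)).support, |C| * |C'| := by
            refine norm_sum_le_of_le _ fun z _ => ?_
            rw [norm_mul]
            exact mul_le_mul ((hC _ _).trans (le_abs_self _)) ((hC' _ _).trans (le_abs_self _))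
              (norm_nonneg _) (abs_nonneg _)
        _ = (S (Finsupp.single y 1)).support.card * (|C| * |C'|) := by simp
        _ ≤ N * (|C| * |C'|) := by gcongr
    · rw [entry_mul] at h
      obtain ⟨z, _, hz⟩ := Finset.exists_ne_zero_of_sum_ne_zero h
      have h1 := hR x z (left_ne_zero_of_mul hz)
      have h2 := hR' z y (right_ne_zero_of_mul hz)
      calc edist x y ≤ edist x z + edist z y := edist_triangle _ _ _
        _ ≤ R + R' := add_le_add h1 h2
        _ = ((R + R' : ℝ≥0) : ℝ≥0∞) := by simp
  algebraMap_mem' := by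
    intro r
    classical
    have hr : ∀ x y : X, entry (algebraMap ℂ (Module.End ℂ (X →₀ ℂ)) r) x y
        = r * Finsupp.single y (1 : ℂ) x := fun x y => rfl
    refine ⟨⟨‖r‖, fun x y => ?_⟩, 0, fun x y h => ?_⟩
    · rw [hr, Finsupp.single_apply]
      split_ifs <;> simp
    · rw [hr, Finsupp.single_apply] at h
      split_ifs at h with hxy
      · simp [hxy]
      · simp at h

section Roe

variable {X : Type u} [EMetricSpace X] [BoundedGeometry X]

theorem uniformRoe_ext {T S : uniformRoe X} (h : ∀ x y, entry T.1 x y = entry S.1 x y) :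
    T = S := by
  apply Subtype.ext
  apply Finsupp.lhom_ext'
  intro y
  apply LinearMap.ext_ring
  ext x
  exact h x y

theorem finite_column {T : X → X → ℂ} (hp : ∃ R : ℝ≥0, ∀ x y, T x y ≠ 0 → edist x y ≤ R) (y : X) :
    (Function.support fun x => T x y).Finite := by
  obtain ⟨R, hR⟩ := hp
  obtain ⟨N, hN⟩ := BoundedGeometry.exists_bound (X := X) R
  have hfin : {z : X | edist y z ≤ R}.Finite :=
    Set.finite_of_encard_le_coe (hN y)
  refine hfin.subset fun x hx => ?_
  simpa [edist_comm] using hR x y hx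

/-- The operator on finitely supported functions given by a matrix with finite columns. -/
def matrixOp (T : X → X → ℂ) (hp : ∃ R : ℝ≥0, ∀ x y, T x y ≠ 0 → edist x y ≤ R) :
    Module.End ℂ (X →₀ ℂ) :=
  Finsupp.linearCombination ℂ fun y => Finsupp.ofSupportFinite (fun x => T x y) (finite_column hp y)

theorem entry_matrixOp (T : X → X → ℂ) (hp : ∃ R : ℝ≥0, ∀ x y, T x y ≠ 0 → edist x y ≤ R)
    (x y : X) : entry (matrixOp T hp) x y = T x y := by
  simp [entry, matrixOp, Finsupp.linearCombination_single, Finsupp.ofSupportFinite_coe]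

/-- The element of `ℂ_u[X]` given by a bounded matrix of finite propagation. -/
def ofMatrix (T : X → X → ℂ) (hb : ∃ C : ℝ, ∀ x y, ‖T x y‖ ≤ C)
    (hp : ∃ R : ℝ≥0, ∀ x y, T x y ≠ 0 → edist x y ≤ R) : uniformRoe X :=
  ⟨matrixOp T hp, by simpa only [entry_matrixOp] using hb,
    by simpa only [entry_matrixOp] using hp⟩

theorem entry_ofMatrix (T : X → X → ℂ) (hb : ∃ C : ℝ, ∀ x y, ‖T x y‖ ≤ C)
    (hp : ∃ R : ℝ≥0, ∀ x y, T x y ≠ 0 → edist x y ≤ R) (x y : X) :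
    entry (ofMatrix T hb hp).1 x y = T x y := entry_matrixOp T hp x y

open Classical in
/-- The embedding of `ℓ^∞(X)` into `ℂ_u[X]` as diagonal matrices. -/
def diag (f : EllInfty X) : uniformRoe X :=
  ofMatrix (fun x y => if x = y then f x else 0)
    ⟨‖f‖, fun x y => by
      split_ifs
      · exact lp.norm_apply_le_norm (by simp) f x
      · simp⟩
    ⟨0, fun x y h => by
      have : x = y := by
        by_contra hxy
        simp [hxy] at h
      simp [this]⟩

/-- The support of `T`. -/
def supp (T : uniformRoe X) : Set (X × X) := {p | entry T.1 p.1 p.2 ≠ 0}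

/-- Partial translations: all entries are `0` or `1`, with at most one `1` in each row and in
each column. -/
structure IsPartialTranslation (V : uniformRoe X) : Prop where
  zero_or_one : ∀ x y, entry V.1 x y = 0 ∨ entry V.1 x y = 1
  row : ∀ x y y', (x, y) ∈ supp V → (x, y') ∈ supp V → y = y'
  col : ∀ x x' y, (x, y) ∈ supp V → (x', y) ∈ supp V → x = x'

theorem memlp_rowSum (T : uniformRoe X) :
    Memℓp (fun x => ∑ᶠ y, entry T.1 x y : X → ℂ) ∞ := by
  obtain ⟨T, ⟨C, hC⟩, R, hR⟩ := T
  obtain ⟨N, hN⟩ := BoundedGeometry.exists_bound (X := X) R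
  apply memℓp_infty
  refine ⟨N * |C|, ?_⟩
  rintro _ ⟨x, rfl⟩
  have hfin : {z : X | edist x z ≤ R}.Finite := Set.finite_of_encard_le_coe (hN x)
  have hsub : (Function.support fun y => entry T x y) ⊆ hfin.toFinset := by
    intro y hy
    simpa using hR x y hy
  have hcard : (hfin.toFinset.card : ℝ) ≤ N := by
    have h2 := hN x
    rw [← hfin.coe_toFinset, Set.encard_coe_eq_coe_finsetCard] at h2
    exact_mod_cast h2
  show ‖∑ᶠ y, entry T x y‖ ≤ _
  rw [finsum_eq_sum_of_support_subset _ hsub]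
  calc ‖∑ y ∈ hfin.toFinset, entry T x y‖ ≤ ∑ y ∈ hfin.toFinset, |C| :=
        norm_sum_le_of_le _ fun y _ => (hC x y).trans (le_abs_self C)
    _ = hfin.toFinset.card * |C| := by simp
    _ ≤ N * |C| := by gcongr

/-- The map `Φ : ℂ_u[X] → ℓ^∞(X)`, `Φ(T)(x) = ∑_y T_{xy}`. -/
def rowSum (T : uniformRoe X) : EllInfty X :=
  ⟨fun x => ∑ᶠ y, entry T.1 x y, memlp_rowSum T⟩

/-- The `ℓ¹`-norm: the infimum of `∑ ‖f_i‖` over all finite decompositions `T = ∑ f_i V_i` with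
`f_i ∈ ℓ^∞(X)` and `V_i` partial translations. -/
def l1Norm (T : uniformRoe X) : ℝ :=
  sInf {r : ℝ | ∃ (N : ℕ) (f : Fin N → EllInfty X) (V : Fin N → uniformRoe X),
    (∀ i, IsPartialTranslation (V i)) ∧ T = ∑ i, diag (f i) * V i ∧ r = ∑ i, ‖f i‖}

end Roe

/-! ## Representations and geometric Banach property (T) -/

/-- A representation of `ℂ_u[X]` on `B`: a unital algebra homomorphism into the bounded operators
which is contractive for the `ℓ¹`-norm. -/
structure RoeRep (X : Type u) [EMetricSpace X] [BoundedGeometry X]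
    (B : Type v) [NormedAddCommGroup B] [NormedSpace ℂ B] where
  toAlgHom : uniformRoe X →ₐ[ℂ] (B →L[ℂ] B)
  contractive : ∀ T : uniformRoe X, ‖toAlgHom T‖ ≤ l1Norm T

section GeomT

variable {X : Type u} [EMetricSpace X] [BoundedGeometry X]
  {B : Type v} [NormedAddCommGroup B] [NormedSpace ℂ B]

/-- `π(V) - π(Φ(V))`. -/
def RoeRep.defect (π : RoeRep X B) (V : uniformRoe X) : B →L[ℂ] B :=
  π.toAlgHom V - π.toAlgHom (diag (rowSum V))

/-- The subspace `B^π` of invariant vectors. -/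
def RoeRep.invariants (π : RoeRep X B) : Submodule ℂ B where
  carrier := {ξ | ∀ V : uniformRoe X, IsPartialTranslation V →
    π.toAlgHom V ξ = π.toAlgHom (diag (rowSum V)) ξ}
  add_mem' := by
    intro a b ha hb V hV
    rw [map_add, map_add, ha V hV, hb V hV]
  zero_mem' := by
    intro V _
    rw [map_zero, map_zero]
  smul_mem' := by
    intro c a ha V hV
    rw [map_smul, map_smul, ha V hV]

/-- `π` has spectral gap at least `c` relative to the entourage `E₀`: every unit vector `[ξ]` of
the quotient Banach space `B ⧸ B^π` is moved by at least `c` by some partial translation supported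
in `E₀`. The operator `π(V) - π(Φ(V))` kills `B^π`, so the class of `(π(V) - π(Φ(V))) ξ`
depends only on `[ξ]`. -/
def RoeRep.HasSpectralGap (π : RoeRep X B) (E₀ : Set (X × X)) (c : ℝ) : Prop :=
  ∀ ξ : B, ‖(Submodule.Quotient.mk ξ : B ⧸ π.invariants)‖ = 1 →
    ∃ V : uniformRoe X, IsPartialTranslation V ∧ supp V ⊆ E₀ ∧
      c ≤ ‖(Submodule.Quotient.mk (π.defect V ξ) : B ⧸ π.invariants)‖

variable (X B)

/-- Geometric property `(T_B)`: every representation of `ℂ_u[X]` on `B` has a spectral gap, measured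
by a symmetric generating entourage `E₀` of `X`. -/
def GeometricT : Prop :=
  ∃ E₀ : Set (X × X), IsGenerating E₀ ∧
    ∀ π : RoeRep X B, ∃ c : ℝ, 0 < c ∧ π.HasSpectralGap E₀ c

/-- Uniform geometric property `(T_B)`: the gap does not depend on the representation. -/
def UniformGeometricT : Prop :=
  ∃ E₀ : Set (X × X), IsGenerating E₀ ∧
    ∃ c : ℝ, 0 < c ∧ ∀ π : RoeRep X B, π.HasSpectralGap E₀ c

end GeomT

/-! ## Banach property (T) for groups -/

section GroupT

variable {G : Type u} [Group G] {B : Type v} [NormedAddCommGroup B] [NormedSpace ℂ B]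

/-- The subspace `B^ρ` of invariant vectors of a linear isometric representation. -/
def groupInvariants (ρ : G →* (B ≃ₗᵢ[ℂ] B)) : Submodule ℂ B where
  carrier := {ξ | ∀ g, ρ g ξ = ξ}
  add_mem' := by
    intro a b ha hb g
    rw [map_add, ha g, hb g]
  zero_mem' := by
    intro g
    rw [map_zero]
  smul_mem' := by
    intro c a ha g
    rw [map_smul, ha g]

/-- The representation induced by `ρ` on `B ⧸ B^ρ` has a `c`-almost invariant vector: a unit
vector `[ξ]` with `‖[ρ(g)ξ] - [ξ]‖ ≤ c` for all `g ∈ S`. -/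
def HasAlmostInvariantVector (ρ : G →* (B ≃ₗᵢ[ℂ] B)) (S : Set G) (c : ℝ) : Prop :=
  ∃ ξ : B, ‖(Submodule.Quotient.mk ξ : B ⧸ groupInvariants ρ)‖ = 1 ∧
    ∀ g ∈ S, ‖(Submodule.Quotient.mk (ρ g ξ) - Submodule.Quotient.mk ξ :
      B ⧸ groupInvariants ρ)‖ ≤ c

/-- `S` is a finite symmetric generating set of `G`. -/
structure IsFiniteSymmGenSet (S : Set G) : Prop where
  finite : S.Finite
  symm : ∀ s ∈ S, s⁻¹ ∈ S
  gen : Subgroup.closure S = ⊤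

variable (G B)

/-- Property `(T_B)` of a finitely generated group, for every choice of the finite symmetric
generating set. -/
def PropertyT : Prop :=
  Group.FG G ∧ ∀ S : Set G, IsFiniteSymmGenSet S →
    ∀ ρ : G →* (B ≃ₗᵢ[ℂ] B), ∃ c : ℝ, 0 < c ∧ ¬ HasAlmostInvariantVector ρ S c

/-- Uniform property `(T_B)`: the constant does not depend on the representation. -/
def UniformPropertyT : Prop :=
  Group.FG G ∧ ∀ S : Set G, IsFiniteSymmGenSet S →
    ∃ c : ℝ, 0 < c ∧ ∀ ρ : G →* (B ≃ₗᵢ[ℂ] B), ¬ HasAlmostInvariantVector ρ S c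

end GroupT

/-! ## Sequences of finite groups: the separated disjoint union and the limit group -/

/-- The word length of `g` with respect to `S`. -/
def wordLength {G : Type u} [Group G] (S : Set G) (g : G) : ℕ :=
  sInf {k | ∃ L : List G, L.length = k ∧ (∀ s ∈ L, s ∈ S) ∧ L.prod = g}

section WordLength

variable {G : Type u} [Group G] {S : Set G}

theorem exists_word (hsymm : ∀ s ∈ S, s⁻¹ ∈ S) (hgen : Subgroup.closure S = ⊤) (g : G) :
    ∃ L : List G, (∀ s ∈ L, s ∈ S) ∧ L.prod = g := by
  have hg : g ∈ (Subgroup.closure S).toSubmonoid := by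
    rw [hgen]
    exact Submonoid.mem_top g
  rw [Subgroup.closure_toSubmonoid] at hg
  obtain ⟨L, hL, h⟩ := Submonoid.exists_list_of_mem_closure hg
  refine ⟨L, fun s hs => ?_, h⟩
  rcases hL s hs with h | h
  · exact h
  · simpa using hsymm _ (Set.mem_inv.1 h)

theorem exists_min_word (hsymm : ∀ s ∈ S, s⁻¹ ∈ S) (hgen : Subgroup.closure S = ⊤) (g : G) :
    ∃ L : List G, L.length = wordLength S g ∧ (∀ s ∈ L, s ∈ S) ∧ L.prod = g := by
  obtain ⟨L, hL, h⟩ := exists_word hsymm hgen g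
  exact Nat.sInf_mem (s := {k | ∃ L : List G, L.length = k ∧ (∀ s ∈ L, s ∈ S) ∧ L.prod = g})
    ⟨L.length, L, rfl, hL, h⟩

theorem wordLength_le {L : List G} (hL : ∀ s ∈ L, s ∈ S) : wordLength S L.prod ≤ L.length :=
  Nat.sInf_le ⟨L, rfl, hL, rfl⟩

theorem wordLength_one : wordLength S (1 : G) = 0 := by
  have := wordLength_le (S := S) (L := []) (by simp)
  simpa using this

theorem eq_one_of_wordLength_eq_zero (hsymm : ∀ s ∈ S, s⁻¹ ∈ S)
    (hgen : Subgroup.closure S = ⊤) {g : G} (h : wordLength S g = 0) : g = 1 := by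
  obtain ⟨L, hL, _, hg⟩ := exists_min_word hsymm hgen g
  rw [h, List.length_eq_zero_iff] at hL
  rw [← hg, hL, List.prod_nil]

theorem wordLength_mul_le (hsymm : ∀ s ∈ S, s⁻¹ ∈ S) (hgen : Subgroup.closure S = ⊤) (g h : G) :
    wordLength S (g * h) ≤ wordLength S g + wordLength S h := by
  obtain ⟨L, hL, hLS, hg⟩ := exists_min_word hsymm hgen g
  obtain ⟨M, hM, hMS, hh⟩ := exists_min_word hsymm hgen h
  have := wordLength_le (S := S) (L := L ++ M) (by
    intro s hs
    rcases List.mem_append.1 hs with h | h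
    · exact hLS s h
    · exact hMS s h)
  rwa [List.prod_append, hg, hh, List.length_append, hL, hM] at this

theorem wordLength_inv_le (hsymm : ∀ s ∈ S, s⁻¹ ∈ S) (hgen : Subgroup.closure S = ⊤) (g : G) :
    wordLength S g⁻¹ ≤ wordLength S g := by
  obtain ⟨L, hL, hLS, hg⟩ := exists_min_word hsymm hgen g
  have := wordLength_le (S := S) (L := (L.map fun x => x⁻¹).reverse) (by
    intro s hs
    simp only [List.mem_reverse, List.mem_map] at hs
    obtain ⟨t, ht, rfl⟩ := hs
    exact hsymm t (hLS t ht))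
  rwa [← List.prod_inv_reverse, hg, List.length_reverse, List.length_map, hL] at this

theorem wordLength_inv (hsymm : ∀ s ∈ S, s⁻¹ ∈ S) (hgen : Subgroup.closure S = ⊤) (g : G) :
    wordLength S g⁻¹ = wordLength S g :=
  le_antisymm (wordLength_inv_le hsymm hgen g)
    (by simpa using wordLength_inv_le hsymm hgen g⁻¹)

theorem encard_wordLength_le (hsymm : ∀ s ∈ S, s⁻¹ ∈ S) (hgen : Subgroup.closure S = ⊤)
    {N : ℕ} (hN : S.encard ≤ N) (k : ℕ) :
    {g : G | wordLength S g ≤ k}.encard ≤ ((N + 1) ^ k : ℕ) := by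
  induction k with
  | zero =>
    have : {g : G | wordLength S g ≤ 0} ⊆ {1} := by
      intro g hg
      exact eq_one_of_wordLength_eq_zero hsymm hgen (Nat.le_zero.1 hg)
    simpa using Set.encard_le_encard this
  | succ k ih =>
    have hsub : {g : G | wordLength S g ≤ k + 1} ⊆
        (fun p : G × G => p.1 * p.2) '' ((insert 1 S) ×ˢ {g : G | wordLength S g ≤ k}) := by
      intro g hg
      obtain ⟨L, hL, hLS, hLg⟩ := exists_min_word hsymm hgen g
      rcases L with _ | ⟨s, L⟩
      · refine ⟨(1, 1), ⟨Set.mem_insert _ _, ?_⟩, ?_⟩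
        · simp [wordLength_one]
        · simpa using hLg
      · refine ⟨(s, L.prod), ⟨Set.mem_insert_of_mem _ (hLS s (by simp)), ?_⟩, ?_⟩
        · have h1 := wordLength_le (S := S) (L := L) (fun t ht => hLS t (by simp [ht]))
          have h2 : wordLength S g ≤ k + 1 := hg
          simp only [List.length_cons] at hL
          show wordLength S L.prod ≤ k
          omega
        · simpa using hLg
    have h1 : (insert (1 : G) S).encard ≤ ((N + 1 : ℕ) : ℕ∞) :=
      (Set.encard_insert_le S 1).trans (by push_cast; gcongr)
    calc {g : G | wordLength S g ≤ k + 1}.encard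
        ≤ ((insert (1 : G) S) ×ˢ {g : G | wordLength S g ≤ k}).encard :=
          (Set.encard_le_encard hsub).trans (Set.encard_image_le _ _)
      _ = (insert (1 : G) S).encard * {g : G | wordLength S g ≤ k}.encard := Set.encard_prod
      _ ≤ ((N + 1 : ℕ) : ℕ∞) * ((N + 1) ^ k : ℕ) := mul_le_mul' h1 ih
      _ = ((N + 1) ^ (k + 1) : ℕ) := by
        rw [pow_succ]
        push_cast
        ring

end WordLength

/-- A uniformly finite sequence of symmetric generating sets `S_n ⊆ Γ_n`. -/
structure GeneratingSystem (Γ : ℕ → Type u) [∀ n, Group (Γ n)] where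
  S : ∀ n, Set (Γ n)
  symm : ∀ n, ∀ s ∈ S n, s⁻¹ ∈ S n
  gen : ∀ n, Subgroup.closure (S n) = ⊤
  bound : ∃ N : ℕ, ∀ n, (S n).encard ≤ N

section Sequence

variable {Γ : ℕ → Type u} [∀ n, Group (Γ n)]

/-- The length function `l_n` on `Γ_n`. -/
def GeneratingSystem.len (D : GeneratingSystem Γ) (n : ℕ) (g : Γ n) : ℕ := wordLength (D.S n) g

theorem GeneratingSystem.len_one (D : GeneratingSystem Γ) (n : ℕ) : D.len n 1 = 0 :=
  wordLength_one

theorem GeneratingSystem.eq_one (D : GeneratingSystem Γ) {n : ℕ} {g : Γ n} (h : D.len n g = 0) :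
    g = 1 := eq_one_of_wordLength_eq_zero (D.symm n) (D.gen n) h

theorem GeneratingSystem.len_mul (D : GeneratingSystem Γ) {n : ℕ} (g h : Γ n) :
    D.len n (g * h) ≤ D.len n g + D.len n h := wordLength_mul_le (D.symm n) (D.gen n) g h

theorem GeneratingSystem.len_inv (D : GeneratingSystem Γ) {n : ℕ} (g : Γ n) :
    D.len n g⁻¹ = D.len n g := wordLength_inv (D.symm n) (D.gen n) g

/-- The underlying set of the separated disjoint union `X = ⨆_n Γ_n`. -/
def SepUnion (_D : GeneratingSystem Γ) : Type u := Σ n, Γ n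

/-- The distance of the separated disjoint union: `d((n, g), (n, h)) = l_n(g⁻¹ h)`, and
`d((n, g), (m, h)) = ∞` for `n ≠ m`. -/
def sepDist (D : GeneratingSystem Γ) (x y : SepUnion D) : ℝ≥0∞ :=
  if h : x.1 = y.1 then (D.len y.1 ((h ▸ x.2)⁻¹ * y.2) : ℝ≥0∞) else ∞

theorem sepDist_same (D : GeneratingSystem Γ) (n : ℕ) (g h : Γ n) :
    sepDist D ⟨n, g⟩ ⟨n, h⟩ = (D.len n (g⁻¹ * h) : ℝ≥0∞) := by
  simp [sepDist]

theorem sepDist_ne (D : GeneratingSystem Γ) {n m : ℕ} (hnm : n ≠ m) (g : Γ n) (h : Γ m) :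
    sepDist D ⟨n, g⟩ ⟨m, h⟩ = ∞ := by
  simp [sepDist, hnm]

instance (D : GeneratingSystem Γ) : EMetricSpace (SepUnion D) where
  edist := sepDist D
  edist_self := by
    rintro ⟨n, g⟩
    rw [sepDist_same]
    simp [D.len_one]
  edist_comm := by
    rintro ⟨n, g⟩ ⟨m, h⟩
    by_cases hnm : n = m
    · subst hnm
      rw [sepDist_same, sepDist_same, ← D.len_inv (g⁻¹ * h)]
      simp
    · rw [sepDist_ne D hnm, sepDist_ne D (Ne.symm hnm)]
  edist_triangle := by
    rintro ⟨n, g⟩ ⟨m, h⟩ ⟨k, l⟩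
    by_cases hnm : n = m
    · subst hnm
      by_cases hnk : n = k
      · subst hnk
        rw [sepDist_same, sepDist_same, sepDist_same]
        have := D.len_mul (g⁻¹ * h) (h⁻¹ * l)
        rw [show g⁻¹ * h * (h⁻¹ * l) = g⁻¹ * l by group] at this
        exact_mod_cast this
      · rw [sepDist_ne D hnk h l]
        simp
    · rw [sepDist_ne D hnm]
      simp
  eq_of_edist_eq_zero := by
    rintro ⟨n, g⟩ ⟨m, h⟩ hd
    replace hd : sepDist D ⟨n, g⟩ ⟨m, h⟩ = 0 := hd
    by_cases hnm : n = m
    · subst hnm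
      rw [sepDist_same] at hd
      have h1 : g⁻¹ * h = 1 := D.eq_one (by exact_mod_cast hd)
      rw [inv_mul_eq_one.1 h1]
    · rw [sepDist_ne D hnm] at hd
      simp at hd

theorem edist_eq_sepDist (D : GeneratingSystem Γ) (x y : SepUnion D) :
    edist x y = sepDist D x y := rfl

instance (D : GeneratingSystem Γ) : BoundedGeometry (SepUnion D) where
  exists_bound := by
    intro R
    obtain ⟨N, hN⟩ := D.bound
    refine ⟨(N + 1) ^ ⌊R⌋₊, ?_⟩
    rintro ⟨n, g⟩
    have hsub : {y : SepUnion D | sepDist D ⟨n, g⟩ y ≤ R} ⊆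
        (fun h : Γ n => (⟨n, g * h⟩ : SepUnion D)) '' {h | wordLength (D.S n) h ≤ ⌊R⌋₊} := by
      rintro ⟨m, h⟩ hy
      replace hy : sepDist D ⟨n, g⟩ ⟨m, h⟩ ≤ R := hy
      by_cases hnm : n = m
      · subst hnm
        rw [sepDist_same] at hy
        refine ⟨g⁻¹ * h, Nat.le_floor (by exact_mod_cast hy), ?_⟩
        show (⟨n, g * (g⁻¹ * h)⟩ : SepUnion D) = ⟨n, h⟩
        rw [mul_inv_cancel_left]
      · rw [sepDist_ne D hnm] at hy
        simp at hy
    exact (Set.encard_le_encard hsub).trans ((Set.encard_image_le _ _).trans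
      (encard_wordLength_le (D.symm n) (D.gen n) (hN n) _))

/-- The entourage `{(x, xs) : x ∈ Γ_n, s ∈ S_n, n ∈ ℕ}`. -/
def cayleyEntourage (D : GeneratingSystem Γ) : Set (SepUnion D × SepUnion D) :=
  {p | ∃ (n : ℕ) (x s : Γ n), s ∈ D.S n ∧ p = (⟨n, x⟩, ⟨n, x * s⟩)}

/-- `X` is monogenic, with generating entourage `{(x, xs)}`. -/
theorem isGenerating_cayleyEntourage (D : GeneratingSystem Γ) :
    IsGenerating (cayleyEntourage D) where
  isEntourage := by
    refine ⟨1, ?_⟩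
    rintro _ ⟨n, x, s, hs, rfl⟩
    show sepDist D ⟨n, x⟩ ⟨n, x * s⟩ ≤ _
    rw [sepDist_same, inv_mul_cancel_left]
    have := wordLength_le (S := D.S n) (L := [s]) (by simpa using hs)
    simp only [List.prod_singleton, List.length_singleton] at this
    exact_mod_cast this
  symm := by
    rintro _ _ ⟨n, x, s, hs, h⟩
    obtain ⟨rfl, rfl⟩ := Prod.mk.inj h
    exact ⟨n, x * s, s⁻¹, D.symm n s hs, by simp⟩
  generates := by
    have key : ∀ (n : ℕ) (L : List (Γ n)), (∀ s ∈ L, s ∈ D.S n) → ∀ x : Γ n,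
        ((⟨n, x⟩, ⟨n, x * L.prod⟩) : SepUnion D × SepUnion D) ∈
          powRel (cayleyEntourage D) L.length := by
      intro n L
      induction L using List.reverseRecOn with
      | nil =>
        intro _ x
        show (⟨n, x⟩ : SepUnion D) = ⟨n, x * 1⟩
        rw [mul_one]
      | append_singleton L s ih =>
        intro hL x
        rw [List.length_append, List.length_singleton]
        refine ⟨⟨n, x * L.prod⟩, ih (fun t ht => hL t (by simp [ht])) x,
          n, x * L.prod, s, hL s (by simp), ?_⟩
        simp [mul_assoc]
    rintro F ⟨R, hR⟩
    refine ⟨⌊R⌋₊, ?_⟩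
    rintro ⟨⟨n, x⟩, ⟨m, y⟩⟩ hp
    have hd : sepDist D ⟨n, x⟩ ⟨m, y⟩ ≤ R := hR _ hp
    by_cases hnm : n = m
    · subst hnm
      rw [sepDist_same] at hd
      obtain ⟨L, hL, hLS, hprod⟩ := exists_min_word (D.symm n) (D.gen n) (x⁻¹ * y)
      have hlen : L.length ≤ ⌊R⌋₊ := by
        rw [hL]
        exact Nat.le_floor (by exact_mod_cast hd)
      refine Set.mem_iUnion₂.2 ⟨L.length, hlen, ?_⟩
      have := key n L hLS x
      rwa [hprod, mul_inv_cancel_left] at this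
    · rw [sepDist_ne D hnm] at hd
      simp at hd

/-- The group `∏ᵇ Γ_n` of sequences with bounded lengths. -/
def boundedSeq (D : GeneratingSystem Γ) : Subgroup (∀ n, Γ n) where
  carrier := {γ | ∃ K : ℕ, ∀ n, D.len n (γ n) ≤ K}
  one_mem' := ⟨0, fun n => (D.len_one n).le⟩
  mul_mem' := by
    rintro a b ⟨K, hK⟩ ⟨K', hK'⟩
    exact ⟨K + K', fun n => (D.len_mul (a n) (b n)).trans (add_le_add (hK n) (hK' n))⟩
  inv_mem' := by
    rintro a ⟨K, hK⟩
    exact ⟨K, fun n => (D.len_inv (a n)).le.trans (hK n)⟩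

/-- The subgroup `{γ ∈ ∏ᵇ Γ_n : lim_{n → ω} l_n(γ_n) = 0}`. -/
def nullSeq (D : GeneratingSystem Γ) (ω : Ultrafilter ℕ) : Subgroup (boundedSeq D) where
  carrier := {γ | Filter.Tendsto (fun n => D.len n (γ.1 n)) (ω : Filter ℕ) (𝓝 0)}
  one_mem' := by
    have : (fun n => D.len n ((1 : boundedSeq D).1 n)) = fun _ => 0 :=
      funext fun n => D.len_one n
    show Filter.Tendsto _ _ _
    rw [this]
    exact tendsto_const_nhds
  mul_mem' := by
    intro a b ha hb
    have h := Filter.Tendsto.add ha hb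
    rw [add_zero] at h
    exact tendsto_of_tendsto_of_tendsto_of_le_of_le tendsto_const_nhds h
      (fun _ => Nat.zero_le _) (fun n => D.len_mul (a.1 n) (b.1 n))
  inv_mem' := by
    intro a ha
    have : (fun n => D.len n ((a⁻¹ : boundedSeq D).1 n)) = fun n => D.len n (a.1 n) :=
      funext fun n => D.len_inv (a.1 n)
    show Filter.Tendsto _ _ _
    rw [this]
    exact ha

instance (D : GeneratingSystem Γ) (ω : Ultrafilter ℕ) : (nullSeq D ω).Normal where
  conj_mem := by
    intro a ha g
    have ha' : ∀ᶠ n in (ω : Filter ℕ), D.len n (a.1 n) = 0 := by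
      have h : Filter.Tendsto (fun n => D.len n (a.1 n)) (ω : Filter ℕ) (𝓝 0) := ha
      rw [nhds_discrete] at h
      exact Filter.tendsto_pure.1 h
    show Filter.Tendsto (fun n => D.len n ((g * a * g⁻¹ : boundedSeq D).1 n)) (ω : Filter ℕ) (𝓝 0)
    rw [nhds_discrete, Filter.tendsto_pure]
    filter_upwards [ha'] with n hn
    have h1 : a.1 n = 1 := D.eq_one hn
    have h2 : (g * a * g⁻¹ : boundedSeq D).1 n = g.1 n * a.1 n * (g.1 n)⁻¹ := rfl
    rw [h2, h1, mul_one, mul_inv_cancel, D.len_one]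

/-- The limit group `Γ^∞_ω`. -/
abbrev LimitGroup (D : GeneratingSystem Γ) (ω : Ultrafilter ℕ) : Type u :=
  boundedSeq D ⧸ nullSeq D ω

/-! ## The space `Y` and the invariant measure -/

/-- The functions `f ∈ ℓ^∞(X)` with `lim_{n → ω} ‖f|_{Γ_n}‖_∞ = 0`, that is, the intersection of
`ℓ^∞(X)` with the ideal defining the algebra at infinity. -/
def IsNull (D : GeneratingSystem Γ) (ω : Ultrafilter ℕ) (f : EllInfty (SepUnion D)) : Prop :=
  Filter.Tendsto (fun n => ⨆ x : Γ n, ‖f ⟨n, x⟩‖) (ω : Filter ℕ) (𝓝 0)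

/-- The Gelfand spectrum `Y` of the quotient of `ℓ^∞(X)` by the ideal of the null functions: the
characters of `ℓ^∞(X)` which vanish on that ideal, with the weak-* topology. -/
def LimitSpectrum (D : GeneratingSystem Γ) (ω : Ultrafilter ℕ) : Type u :=
  {χ : WeakDual.characterSpace ℂ (EllInfty (SepUnion D)) //
    ∀ f : EllInfty (SepUnion D), IsNull D ω f → χ f = 0}

instance (D : GeneratingSystem Γ) (ω : Ultrafilter ℕ) : TopologicalSpace (LimitSpectrum D ω) :=
  inferInstanceAs (TopologicalSpace {χ : WeakDual.characterSpace ℂ (EllInfty (SepUnion D)) //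
    ∀ f : EllInfty (SepUnion D), IsNull D ω f → χ f = 0})

instance (D : GeneratingSystem Γ) (ω : Ultrafilter ℕ) : MeasurableSpace (LimitSpectrum D ω) :=
  borel _

instance (D : GeneratingSystem Γ) (ω : Ultrafilter ℕ) : BorelSpace (LimitSpectrum D ω) := ⟨rfl⟩

theorem isClosed_limitSpectrum (D : GeneratingSystem Γ) (ω : Ultrafilter ℕ) :
    IsClosed {χ : WeakDual.characterSpace ℂ (EllInfty (SepUnion D)) |
      ∀ f : EllInfty (SepUnion D), IsNull D ω f → χ f = 0} := by
  simp only [Set.ofPred_forall]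
  refine isClosed_iInter fun f => isClosed_iInter fun _ => ?_
  exact isClosed_eq ((WeakDual.eval_continuous f).comp continuous_subtype_val) continuous_const

variable [∀ n, Fintype (Γ n)]

/-- The state `φ_n(f) = ⟨f ξ_n, ξ_n⟩`, the average of `f` over `Γ_n`. -/
def avg (D : GeneratingSystem Γ) (n : ℕ) (f : EllInfty (SepUnion D)) : ℂ :=
  (∑ x : Γ n, f ⟨n, x⟩) / (Fintype.card (Γ n) : ℂ)

/-- The state `φ_ω(f) = lim_{n → ω} φ_n(f)`. -/
def limState (D : GeneratingSystem Γ) (ω : Ultrafilter ℕ) (f : EllInfty (SepUnion D)) : ℂ :=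
  Filter.limUnder (ω : Filter ℕ) fun n => avg D n f

/-- `μ` is the regular Borel probability measure on `Y` representing the state `φ_ω`. -/
structure RepresentsState (D : GeneratingSystem Γ) (ω : Ultrafilter ℕ)
    (μ : Measure (LimitSpectrum D ω)) : Prop where
  regular : μ.Regular
  prob : IsProbabilityMeasure μ
  integral_eq : ∀ f : EllInfty (SepUnion D),
    Integrable (fun χ : LimitSpectrum D ω => χ.1 f) μ ∧
      limState D ω f = ∫ χ : LimitSpectrum D ω, χ.1 f ∂μ

theorem exists_tendsto_ultrafilter (ω : Ultrafilter ℕ) {a : ℕ → ℝ} {C : ℝ}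
    (h : ∀ n, |a n| ≤ C) : ∃ l, Filter.Tendsto a (ω : Filter ℕ) (𝓝 l) := by
  obtain ⟨l, _, hl⟩ := (isCompact_Icc (a := -C) (b := C)).ultrafilter_le_nhds (ω.map a) (by
    rw [Filter.le_principal_iff]
    exact Filter.mem_map.2 (Filter.univ_mem' fun n => abs_le.1 (h n)))
  exact ⟨l, hl⟩

/-- The evaluation character of `ℓ^∞(X)` at a point of `X`. -/
def evalChar {X : Type u} (x : X) : WeakDual.characterSpace ℂ (EllInfty X) :=
  WeakDual.CharacterSpace.equivAlgHom.symm
    { toFun := fun f => f x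
      map_one' := rfl
      map_mul' := fun _ _ => rfl
      map_zero' := rfl
      map_add' := fun _ _ => rfl
      commutes' := fun _ => rfl }

theorem evalChar_apply {X : Type u} (x : X) (f : EllInfty X) : evalChar x f = f x := rfl

/-- The average over `Γ_n` of a continuous function on the spectrum of `ℓ^∞(X)`. -/
def avgC (D : GeneratingSystem Γ) (n : ℕ)
    (g : C(WeakDual.characterSpace ℂ (EllInfty (SepUnion D)), ℝ)) : ℝ :=
  (∑ x : Γ n, g (evalChar (⟨n, x⟩ : SepUnion D))) / (Fintype.card (Γ n) : ℝ)

theorem abs_avgC_le (D : GeneratingSystem Γ) (n : ℕ)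
    (g : C(WeakDual.characterSpace ℂ (EllInfty (SepUnion D)), ℝ)) : |avgC D n g| ≤ ‖g‖ := by
  have hpos : (0 : ℝ) < Fintype.card (Γ n) := by exact_mod_cast Fintype.card_pos
  rw [avgC, abs_div, abs_of_pos hpos, div_le_iff₀ hpos]
  calc |∑ x : Γ n, g (evalChar (⟨n, x⟩ : SepUnion D))|
      ≤ ∑ x : Γ n, ‖g‖ := (Finset.abs_sum_le_sum_abs _ _).trans
        (Finset.sum_le_sum fun x _ => g.norm_coe_le_norm _)
    _ = ‖g‖ * Fintype.card (Γ n) := by simp [mul_comm]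

theorem tendsto_avgC (D : GeneratingSystem Γ) (ω : Ultrafilter ℕ)
    (g : C(WeakDual.characterSpace ℂ (EllInfty (SepUnion D)), ℝ)) :
    Filter.Tendsto (fun n => avgC D n g) (ω : Filter ℕ)
      (𝓝 (Filter.limUnder (ω : Filter ℕ) fun n => avgC D n g)) :=
  tendsto_nhds_limUnder (exists_tendsto_ultrafilter ω fun n => abs_avgC_le D n g)

open CompactlySupported in
/-- The positive functional on the spectrum of `ℓ^∞(X)` induced by the state `φ_ω`. -/
def limFunctional (D : GeneratingSystem Γ) (ω : Ultrafilter ℕ) :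
    C_c(WeakDual.characterSpace ℂ (EllInfty (SepUnion D)), ℝ) →ₚ[ℝ] ℝ :=
  PositiveLinearMap.mk₀
    { toFun := fun g => Filter.limUnder (ω : Filter ℕ) fun n => avgC D n g.toContinuousMap
      map_add' := by
        intro g h
        refine Filter.Tendsto.limUnder_eq ?_
        refine ((tendsto_avgC D ω g.toContinuousMap).add
          (tendsto_avgC D ω h.toContinuousMap)).congr fun n => ?_
        simp only [avgC]
        rw [← add_div, ← Finset.sum_add_distrib]
        rfl
      map_smul' := by
        intro c g
        refine Filter.Tendsto.limUnder_eq ?_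
        refine ((tendsto_avgC D ω g.toContinuousMap).const_mul c).congr fun n => ?_
        simp only [avgC]
        rw [← mul_div_assoc, Finset.mul_sum]
        rfl }
    (by
      intro g hg
      refine ge_of_tendsto' (tendsto_avgC D ω g.toContinuousMap) fun n => ?_
      exact div_nonneg (Finset.sum_nonneg fun x _ => hg _) (Nat.cast_nonneg _))

/-- The measure given by the Riesz representation theorem exists. -/
theorem exists_representsState (D : GeneratingSystem Γ) (ω : Ultrafilter ℕ) :
    ∃ μ : Measure (LimitSpectrum D ω), RepresentsState D ω μ := by
  let Z := WeakDual.characterSpace ℂ (EllInfty (SepUnion D))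
  let _ : MeasurableSpace Z := borel Z
  have _ : BorelSpace Z := ⟨rfl⟩
  let ν : Measure Z := RealRMK.rieszMeasure (limFunctional D ω)
  have hν : ∀ g : C(Z, ℝ), ∫ χ, g χ ∂ν = Filter.limUnder (ω : Filter ℕ) fun n => avgC D n g :=
    fun g => RealRMK.integral_rieszMeasure (limFunctional D ω)
      ⟨g, HasCompactSupport.of_compactSpace _⟩
  have hfin : IsFiniteMeasure ν := by
    show IsFiniteMeasure (RealRMK.rieszMeasure (limFunctional D ω))
    infer_instance
  have hreg : ν.Regular := RealRMK.regular_rieszMeasure _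
  have hcont : ∀ f : EllInfty (SepUnion D), Continuous fun χ : Z => χ f := fun f =>
    (WeakDual.eval_continuous f).comp continuous_subtype_val
  have hone : ν.real Set.univ = 1 := by
    have h := hν 1
    simp only [ContinuousMap.one_apply, integral_const, smul_eq_mul, mul_one] at h
    rw [h]
    refine Filter.Tendsto.limUnder_eq (tendsto_const_nhds.congr fun n => ?_)
    have hpos : (Fintype.card (Γ n) : ℝ) ≠ 0 := by exact_mod_cast Fintype.card_ne_zero
    simp [avgC, hpos]
  -- the null set
  let P : Set Z := {χ : Z | ∀ f : EllInfty (SepUnion D), IsNull D ω f → χ f = 0}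
  have hPc : IsClosed P := isClosed_limitSpectrum D ω
  have hnull : ν Pᶜ = 0 := by
    rw [hPc.isOpen_compl.measure_eq_iSup_isCompact]
    simp only [ENNReal.iSup_eq_zero]
    intro K hKP hK
    refine hK.measure_zero_of_nhdsWithin fun χ hχ => ?_
    have h1 : ∃ f, IsNull D ω f ∧ χ f ≠ 0 := by
      have := hKP hχ
      simpa [P] using this
    obtain ⟨f, hf, hχf⟩ := h1
    let g : C(Z, ℝ) := ⟨fun χ => ‖χ f‖, (hcont f).norm⟩
    have hgnn : ∀ χ, 0 ≤ g χ := fun χ => norm_nonneg (χ f)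
    have hg0 : ∫ χ, g χ ∂ν = 0 := by
      rw [hν g]
      refine Filter.Tendsto.limUnder_eq (squeeze_zero (fun n => ?_) (fun n => ?_) hf)
      · exact div_nonneg (Finset.sum_nonneg fun x _ => hgnn _) (Nat.cast_nonneg _)
      · have hpos : (0 : ℝ) < Fintype.card (Γ n) := by exact_mod_cast Fintype.card_pos
        rw [avgC, div_le_iff₀ hpos]
        calc ∑ x : Γ n, g (evalChar (⟨n, x⟩ : SepUnion D))
            ≤ ∑ x : Γ n, ⨆ x : Γ n, ‖f (⟨n, x⟩ : SepUnion D)‖ :=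
              Finset.sum_le_sum fun x _ =>
                le_ciSup (f := fun x : Γ n => ‖f (⟨n, x⟩ : SepUnion D)‖)
                  (Set.finite_range _).bddAbove x
          _ = _ := by simp [mul_comm]
    have hgi : Integrable (fun χ => g χ) ν := by
      refine Integrable.of_bound g.continuous.aestronglyMeasurable ‖g‖ ?_
      exact Filter.Eventually.of_forall fun χ => g.norm_coe_le_norm χ
    have hae := (integral_eq_zero_iff_of_nonneg hgnn hgi).1 hg0
    refine ⟨{χ : Z | χ f ≠ 0}, mem_nhdsWithin_of_mem_nhds
      (((hcont f).isOpen_preimage _ isOpen_compl_singleton).mem_nhds hχf), ?_⟩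
    have : {χ : Z | χ f ≠ 0} = {χ | ¬ (g χ = (0 : Z → ℝ) χ)} := by
      ext χ
      simp [g]
    rw [this]
    exact hae
  -- restriction to `Y`
  let ι : LimitSpectrum D ω → Z := Subtype.val
  have hι : Topology.IsClosedEmbedding ι := hPc.isClosedEmbedding_subtypeVal
  have hme : MeasurableEmbedding ι := hι.measurableEmbedding
  have hrange : Set.range ι = P := Subtype.range_val
  have hmap : (ν.comap ι).map ι = ν := by
    rw [hme.map_comap, hrange]
    exact Measure.restrict_eq_self_of_ae_mem (mem_ae_iff.2 hnull)
  have hint : ∀ f : EllInfty (SepUnion D), Integrable (fun χ : Z => χ f) ν := by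
    intro f
    let g : C(Z, ℂ) := ⟨fun χ => χ f, hcont f⟩
    refine Integrable.of_bound (hcont f).aestronglyMeasurable ‖g‖ ?_
    exact Filter.Eventually.of_forall fun χ => g.norm_coe_le_norm χ
  have hprob : IsProbabilityMeasure (ν.comap ι) := by
    constructor
    have h1 : (ν.comap ι).map ι Set.univ = (ν.comap ι) Set.univ := by
      rw [hme.map_apply, Set.preimage_univ]
    rw [← h1, hmap, ← ENNReal.toReal_eq_one_iff]
    exact hone
  refine ⟨ν.comap ι, ?_, hprob, fun f => ⟨?_, ?_⟩⟩
  · have hout := Measure.OuterRegular.comap' ν hι.continuous hme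
    refine { hout with lt_top_of_isCompact := fun K _ => measure_lt_top _ _, innerRegular := ?_ }
    intro U hU r hr
    rw [hme.comap_apply] at hr
    obtain ⟨K, hKU, hK, hrK⟩ := MeasurableSet.exists_lt_isCompact_of_ne_top
      (hme.measurableSet_image.2 hU.measurableSet) (measure_ne_top ν _) hr
    have hKr : K ⊆ Set.range ι := hKU.trans (Set.image_subset_range _ _)
    refine ⟨ι ⁻¹' K, ?_, hι.isCompact_preimage hK, ?_⟩
    · rw [← hι.injective.preimage_image U]
      exact Set.preimage_mono hKU
    · rw [hme.comap_apply, Set.image_preimage_eq_of_subset hKr]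
      exact hrK
  · have h := hint f
    rw [← hmap] at h
    exact (hme.integrable_map_iff).1 h
  · have h1 : ∫ χ : LimitSpectrum D ω, χ.1 f ∂(ν.comap ι) = ∫ χ : Z, χ f ∂ν := by
      conv_rhs => rw [← hmap]
      exact (hme.integral_map (fun χ : Z => χ f)).symm
    rw [h1]
    refine Filter.Tendsto.limUnder_eq ?_
    let gr : C(Z, ℝ) := ⟨fun χ => (χ f).re, Complex.continuous_re.comp (hcont f)⟩
    let gi : C(Z, ℝ) := ⟨fun χ => (χ f).im, Complex.continuous_im.comp (hcont f)⟩
    have tr := tendsto_avgC D ω gr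
    have ti := tendsto_avgC D ω gi
    rw [← hν] at tr ti
    have hre : ∫ χ, gr χ ∂ν = (∫ χ : Z, χ f ∂ν).re :=
      (ContinuousLinearMap.integral_comp_comm Complex.reCLM (hint f))
    have him : ∫ χ, gi χ ∂ν = (∫ χ : Z, χ f ∂ν).im :=
      (ContinuousLinearMap.integral_comp_comm Complex.imCLM (hint f))
    rw [hre] at tr
    rw [him] at ti
    have key := tr.ofReal.add (ti.ofReal.mul_const Complex.I)
    have e : ((∫ χ : Z, χ f ∂ν).re : ℂ) + ((∫ χ : Z, χ f ∂ν).im : ℂ) * Complex.I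
        = ∫ χ : Z, χ f ∂ν := Complex.re_add_im _
    refine (e ▸ key).congr fun n => ?_
    apply Complex.ext
    · simp [avg, avgC, gr, gi, Complex.div_natCast_re]
      rfl
    · simp [avg, avgC, gr, gi, Complex.div_natCast_im]
      rfl

/-- The measure `μ_{φ_ω}` on `Y`: the regular Borel probability measure with
`φ_ω(f) = ∫_Y f dμ_{φ_ω}` provided by the Riesz representation theorem. -/
def limitMeasure (D : GeneratingSystem Γ) (ω : Ultrafilter ℕ) : Measure (LimitSpectrum D ω) :=
  Classical.choose (exists_representsState D ω)

theorem limitMeasure_representsState (D : GeneratingSystem Γ) (ω : Ultrafilter ℕ) :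
    RepresentsState D ω (limitMeasure D ω) :=
  Classical.choose_spec (exists_representsState D ω)

end Sequence

end CoarseT

end

/-! Let `G` be the limit group and `ρ` an isometric representation of `G` on `B`. The plan is to
induce `ρ` to a representation of the Roe algebra on `L^p(μ, B)`, and to test its spectral gap on
constant functions.

Bounded sequences act on `X` by right translation, hence on `Y` by homeomorphisms. These preserve
`μ`, because averages over `Γ_n` are translation invariant, and null sequences act trivially. So
`(λ_g ξ)(χ) = ρ(g) ξ(χ·g)` is a representation of `G` on `L^p(μ, B)`, covariant with the
multiplication operators `M_f`. Balls of a fixed radius are uniformly finite, so every matrix of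
finite propagation is a finite sum of terms `f V_γ` (`exists_decomposition`), and `f V_γ ↦ M_f
λ_[γ]` is the desired homomorphism. It is well defined because `ω` is an ultrafilter: two sequences
agree either `ω`-almost everywhere or `ω`-almost nowhere, and translations by distinct elements of
`Γ_n` have disjoint graphs; so the coefficient of a matrix at an element of `G` is determined modulo
null functions, which vanish on `Y`. A partial translation acts as a piecewise isometry with
disjoint pieces and disjoint images, hence as a contraction; this gives the `ℓ¹` bound
(`inducedRep`).

Constant functions embed `B` equivariantly in `L^p(μ, B)`, and integration over `Y` is a contractive
equivariant left inverse. Consequently the embedding is isometric modulo invariant vectors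
(`norm_mk_const`), and the gap applies to constants. The defect of a partial translation supported
in `E₀` is `∑ M_{f_k} (λ_{g_k} - 1)` with `‖f_k‖ ≤ 1` and finitely many `g_k` depending only on `E₀`
(`exists_defect_decomposition`). On a constant `ξ` it is therefore at most a multiple of the largest
`‖ρ(s)ξ - ξ‖`, `s ∈ S`. Almost invariance is only assumed modulo `B^ρ`, but averaging over powers of
`g` shows that `‖ρ(g)ξ - ξ‖` is at most twice its quotient norm
(`norm_apply_sub_le_two_mul_norm_mk`). The resulting constant depends on `E₀`, `S` and the gap only,
so both parts follow. -/

noncomputable section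

namespace CoarseT

universe u v

/-! ### Right translations of `X` and their matrices -/

section Translation

variable {Γ : ℕ → Type u} [∀ n, Group (Γ n)]

/-- Right translation of the separated disjoint union by a sequence of group elements. -/
def rightMul (D : GeneratingSystem Γ) (γ : ∀ n, Γ n) (x : SepUnion D) : SepUnion D :=
  ⟨x.1, x.2 * γ x.1⟩

theorem rightMul_mul (D : GeneratingSystem Γ) (γ δ : ∀ n, Γ n) (x : SepUnion D) :
    rightMul D (γ * δ) x = rightMul D δ (rightMul D γ x) := by
  rcases x with ⟨n, g⟩
  exact congrArg (Sigma.mk n) (mul_assoc g (γ n) (δ n)).symm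

theorem rightMul_one (D : GeneratingSystem Γ) (x : SepUnion D) : rightMul D 1 x = x := by
  rcases x with ⟨n, g⟩
  exact congrArg (Sigma.mk n) (mul_one g)

theorem rightMul_eq_iff (D : GeneratingSystem Γ) {γ δ : ∀ n, Γ n} {x : SepUnion D} :
    rightMul D γ x = rightMul D δ x ↔ γ x.1 = δ x.1 := by
  constructor
  · intro h
    have h2 := eq_of_heq (Sigma.mk.inj h).2
    exact mul_left_cancel h2
  · intro h
    exact congrArg (fun g => (⟨x.1, x.2 * g⟩ : SepUnion D)) h

theorem edist_rightMul (D : GeneratingSystem Γ) (γ : ∀ n, Γ n) (x : SepUnion D) :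
    edist x (rightMul D γ x) = (D.len x.1 (γ x.1) : ℝ≥0∞) := by
  obtain ⟨n, g⟩ := x
  refine (sepDist_same D n g (g * γ n)).trans ?_
  rw [inv_mul_cancel_left]

/-- The action of a sequence of group elements on bounded functions by right translation. -/
def shift (D : GeneratingSystem Γ) (γ : ∀ n, Γ n) :
    EllInfty (SepUnion D) →ₐ[ℂ] EllInfty (SepUnion D) where
  toFun f := ⟨fun x => f (rightMul D γ x), memℓp_infty ⟨‖f‖, by
    rintro _ ⟨x, rfl⟩
    exact lp.norm_apply_le_norm (by simp) f _⟩⟩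
  map_one' := rfl
  map_mul' _ _ := rfl
  map_zero' := rfl
  map_add' _ _ := rfl
  commutes' _ := rfl

theorem shift_apply (D : GeneratingSystem Γ) (γ : ∀ n, Γ n) (f : EllInfty (SepUnion D))
    (x : SepUnion D) : shift D γ f x = f (rightMul D γ x) := rfl

theorem shift_shift (D : GeneratingSystem Γ) (γ δ : ∀ n, Γ n) (f : EllInfty (SepUnion D)) :
    shift D γ (shift D δ f) = shift D (γ * δ) f := by
  ext x
  simp only [shift_apply, rightMul_mul]

theorem shift_one (D : GeneratingSystem Γ) (f : EllInfty (SepUnion D)) : shift D 1 f = f := by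
  ext x
  simp only [shift_apply, rightMul_one]

open Classical in
/-- The operator in the uniform Roe algebra given by a bounded sequence: `(V_γ φ)(x) = φ(xγ)`. -/
def transOp (D : GeneratingSystem Γ) (γ : boundedSeq D) : uniformRoe (SepUnion D) :=
  ofMatrix (fun x y => if y = rightMul D γ.1 x then 1 else 0)
    ⟨1, fun x y => by split_ifs <;> simp⟩
    (by
      obtain ⟨K, hK⟩ := γ.2
      refine ⟨K, fun x y h => ?_⟩
      have hy : y = rightMul D γ.1 x := by
        by_contra hxy
        simp [hxy] at h
      rw [hy, edist_rightMul]
      exact_mod_cast hK x.1)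

open Classical in
theorem entry_transOp (D : GeneratingSystem Γ) (γ : boundedSeq D) (x y : SepUnion D) :
    entry (transOp D γ).1 x y = if y = rightMul D γ.1 x then 1 else 0 :=
  entry_ofMatrix _ _ _ x y

/-- For fixed `x`, the map `φ ↦ (T φ)(x)` is a linear functional, so basis vectors determine it.
This turns formulas for entries into formulas for the action on functions, and products of matrices
into substitutions. -/
theorem apply_eq_of_entry {X : Type u} (T : Module.End ℂ (X →₀ ℂ)) (x : X)
    (F : (X →₀ ℂ) →ₗ[ℂ] ℂ) (h : ∀ y, entry T x y = F (Finsupp.single y 1)) (φ : X →₀ ℂ) :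
    T φ x = F φ := by
  have : (Finsupp.lapply x).comp T = F := by
    apply Finsupp.lhom_ext'
    intro y
    apply LinearMap.ext_ring
    exact h y
  exact LinearMap.congr_fun this φ

theorem transOp_apply (D : GeneratingSystem Γ) (γ : boundedSeq D) (φ : SepUnion D →₀ ℂ)
    (x : SepUnion D) : (transOp D γ).1 φ x = φ (rightMul D γ.1 x) := by
  classical
  refine apply_eq_of_entry _ x (Finsupp.lapply (rightMul D γ.1 x)) (fun y => ?_) φ
  rw [entry_transOp]
  simp [Finsupp.single_apply]

open Classical in
theorem entry_diag {X : Type u} [EMetricSpace X] [BoundedGeometry X] (f : EllInfty X) (x y : X) :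
    entry (diag f).1 x y = if x = y then f x else 0 := entry_ofMatrix _ _ _ x y

theorem diag_apply {X : Type u} [EMetricSpace X] [BoundedGeometry X] (f : EllInfty X)
    (φ : X →₀ ℂ) (x : X) : (diag f).1 φ x = f x * φ x := by
  classical
  refine apply_eq_of_entry _ x (f x • Finsupp.lapply x) (fun y => ?_) φ
  rw [entry_diag]
  simp [Finsupp.single_apply, eq_comm]

theorem entry_diag_mul {X : Type u} [EMetricSpace X] [BoundedGeometry X] (f : EllInfty X)
    (T : uniformRoe X) (x y : X) : entry (diag f * T).1 x y = f x * entry T.1 x y :=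
  diag_apply f _ x

theorem entry_transOp_mul (D : GeneratingSystem Γ) (γ : boundedSeq D)
    (T : uniformRoe (SepUnion D)) (x y : SepUnion D) :
    entry (transOp D γ * T).1 x y = entry T.1 (rightMul D γ.1 x) y :=
  transOp_apply D γ _ x

theorem transOp_mul (D : GeneratingSystem Γ) (γ δ : boundedSeq D) :
    transOp D γ * transOp D δ = transOp D (γ * δ) := by
  classical
  refine uniformRoe_ext fun x y => ?_
  rw [entry_transOp_mul, entry_transOp, entry_transOp, ← rightMul_mul]
  rfl

theorem transOp_one (D : GeneratingSystem Γ) : transOp D 1 = 1 := by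
  refine Subtype.ext (LinearMap.ext fun φ => Finsupp.ext fun x => ?_)
  rw [transOp_apply]
  exact congrArg φ (rightMul_one D x)

theorem diag_one {X : Type u} [EMetricSpace X] [BoundedGeometry X] :
    diag (1 : EllInfty X) = 1 := by
  refine Subtype.ext (LinearMap.ext fun φ => Finsupp.ext fun x => ?_)
  rw [diag_apply]
  exact one_mul (φ x)

theorem diag_mul_diag {X : Type u} [EMetricSpace X] [BoundedGeometry X] (f g : EllInfty X) :
    diag f * diag g = diag (f * g) := by
  classical
  refine uniformRoe_ext fun x y => ?_
  rw [entry_diag_mul, entry_diag, entry_diag, mul_ite, mul_zero]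
  rfl

/-- The covariance relation: together with `transOp_mul` and `diag_mul_diag` it makes the terms `f
V_γ` multiply as in a crossed product. -/
theorem transOp_mul_diag (D : GeneratingSystem Γ) (γ : boundedSeq D)
    (f : EllInfty (SepUnion D)) :
    transOp D γ * diag f = diag (shift D γ.1 f) * transOp D γ := by
  classical
  refine uniformRoe_ext fun x y => ?_
  rw [entry_transOp_mul, entry_diag_mul, entry_diag, entry_transOp, mul_ite, mul_zero, mul_one]
  simp only [eq_comm]
  rfl

theorem isPartialTranslation_transOp (D : GeneratingSystem Γ) (γ : boundedSeq D) :
    IsPartialTranslation (transOp D γ) := by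
  classical
  have hs : ∀ x y, (x, y) ∈ supp (transOp D γ) → y = rightMul D γ.1 x := by
    intro x y h
    have h' : entry (transOp D γ).1 x y ≠ 0 := h
    rw [entry_transOp] at h'
    by_contra hxy
    simp [hxy] at h'
  refine ⟨fun x y => ?_, fun x y y' h h' => (hs x y h).trans (hs x y' h').symm,
    fun x x' y h h' => ?_⟩
  · rw [entry_transOp]
    split_ifs <;> simp
  · have e := (hs x y h).symm.trans (hs x' y h')
    have := congrArg (rightMul D (γ.1)⁻¹) e
    rwa [← rightMul_mul, ← rightMul_mul, mul_inv_cancel, rightMul_one, rightMul_one] at this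

/-- Row `x` of `f V_γ` has the single entry `f(x)`, at `xγ`. As a result, the defect of `f V_γ` will
be `f (V_γ - 1)`. -/
theorem rowSum_diag_mul_transOp (D : GeneratingSystem Γ) (γ : boundedSeq D)
    (f : EllInfty (SepUnion D)) : rowSum (diag f * transOp D γ) = f := by
  classical
  ext x
  show ∑ᶠ y, entry (diag f * transOp D γ).1 x y = f x
  simp only [entry_diag_mul, entry_transOp]
  rw [finsum_eq_single _ (rightMul D γ.1 x) (fun y hy => by simp [hy])]
  simp

/-- The restriction of a matrix to the graph of a translation, as a function of the row. -/
def coefficient (D : GeneratingSystem Γ) (γ : boundedSeq D) :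
    uniformRoe (SepUnion D) →ₗ[ℂ] EllInfty (SepUnion D) where
  toFun T := ⟨fun x => entry T.1 x (rightMul D γ.1 x), memℓp_infty (by
    obtain ⟨C, hC⟩ := T.2.1
    refine ⟨C, ?_⟩
    rintro _ ⟨x, rfl⟩
    exact hC _ _)⟩
  map_add' _ _ := rfl
  map_smul' _ _ := rfl

theorem coefficient_apply (D : GeneratingSystem Γ) (γ : boundedSeq D)
    (T : uniformRoe (SepUnion D)) (x : SepUnion D) :
    coefficient D γ T x = entry T.1 x (rightMul D γ.1 x) := rfl

-- By left cancellation, the graphs of two translations over a component `Γ_n` either coincide or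
-- are disjoint.
open Classical in
theorem coefficient_diag_mul_transOp (D : GeneratingSystem Γ) (γ δ : boundedSeq D)
    (f : EllInfty (SepUnion D)) (x : SepUnion D) :
    coefficient D δ (diag f * transOp D γ) x = if γ.1 x.1 = δ.1 x.1 then f x else 0 := by
  rw [coefficient_apply, entry_diag_mul, entry_transOp]
  simp only [rightMul_eq_iff, mul_ite, mul_one, mul_zero, eq_comm]

theorem isNull_of_eventually (D : GeneratingSystem Γ) (ω : Ultrafilter ℕ)
    {f : EllInfty (SepUnion D)} (h : ∀ᶠ n in (ω : Filter ℕ), ∀ x : SepUnion D, x.1 = n → f x = 0) :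
    IsNull D ω f := by
  refine tendsto_const_nhds.congr' ?_
  filter_upwards [h] with n hn
  have : ∀ x : Γ n, ‖f ⟨n, x⟩‖ = 0 := fun x => by rw [hn ⟨n, x⟩ rfl, norm_zero]
  simp only [this, ciSup_const]

/-- Lengths are integers, so a length tending to `0` along `ω` is `0` almost everywhere, and only
the identity has length `0`. -/
theorem mk_eq_mk_iff (D : GeneratingSystem Γ) (ω : Ultrafilter ℕ) (γ δ : boundedSeq D) :
    (QuotientGroup.mk γ : LimitGroup D ω) = QuotientGroup.mk δ ↔
      ∀ᶠ n in (ω : Filter ℕ), γ.1 n = δ.1 n := by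
  rw [QuotientGroup.eq]
  show Filter.Tendsto (fun n => D.len n ((γ⁻¹ * δ : boundedSeq D).1 n)) _ _ ↔ _
  rw [nhds_discrete, Filter.tendsto_pure]
  refine Filter.eventually_congr (Filter.Eventually.of_forall fun n => ?_)
  have e : (γ⁻¹ * δ : boundedSeq D).1 n = (γ.1 n)⁻¹ * δ.1 n := rfl
  rw [e]
  constructor
  · intro h
    exact inv_mul_eq_one.1 (D.eq_one h)
  · intro h
    rw [h, inv_mul_cancel, D.len_one]

theorem isNull_coefficient_sub (D : GeneratingSystem Γ) (ω : Ultrafilter ℕ) (γ δ : boundedSeq D)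
    (h : (QuotientGroup.mk γ : LimitGroup D ω) = QuotientGroup.mk δ)
    (f : EllInfty (SepUnion D)) :
    IsNull D ω (coefficient D δ (diag f * transOp D γ) - f) := by
  apply isNull_of_eventually
  filter_upwards [(mk_eq_mk_iff D ω γ δ).1 h] with n hn x hx
  subst hx
  rw [lp.coeFn_sub, Pi.sub_apply, coefficient_diag_mul_transOp, if_pos hn, sub_self]

/-- Here `ω` must be an ultrafilter: sequences with different classes differ for `ω`-almost every
`n`, not just for some of them. With `isNull_coefficient_sub` this makes the component of a matrix
at a group element well defined on `Y`. -/
theorem isNull_coefficient (D : GeneratingSystem Γ) (ω : Ultrafilter ℕ) (γ δ : boundedSeq D)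
    (h : (QuotientGroup.mk γ : LimitGroup D ω) ≠ QuotientGroup.mk δ)
    (f : EllInfty (SepUnion D)) :
    IsNull D ω (coefficient D δ (diag f * transOp D γ)) := by
  apply isNull_of_eventually
  rw [Ne, mk_eq_mk_iff, ← Ultrafilter.eventually_not] at h
  filter_upwards [h] with n hn x hx
  subst hx
  rw [coefficient_diag_mul_transOp, if_neg hn]

end Translation

/-! ### Finite propagation matrices as finite sums of translations; finite generation of the limit
group -/

section Decomposition

variable {Γ : ℕ → Type u} [∀ n, Group (Γ n)]

/-- The balls of radius `K` in the groups `Γ_n` are enumerated by finitely many bounded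
sequences. -/
theorem exists_enumeration (D : GeneratingSystem Γ) (K : ℕ) :
    ∃ (M : ℕ) (γ : Fin M → boundedSeq D) (s : ∀ n, Γ n → Fin M),
      ∀ n g, D.len n g ≤ K → (γ (s n g)).1 n = g := by
  classical
  obtain ⟨N, hN⟩ := D.bound
  -- A bound for the balls of radius `K` that is uniform in `n`, so one label set serves all the
  -- groups.
  set M := (N + 1) ^ K
  have hball : ∀ n, ∃ s : Γ n → Fin M, Set.InjOn s {g | D.len n g ≤ K} := by
    intro n
    have hc := encard_wordLength_le (D.symm n) (D.gen n) (hN n) K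
    have : Nonempty (Fin M) := ⟨⟨0, by positivity⟩⟩
    obtain ⟨s, -, hs⟩ := (Set.finite_of_encard_le_coe hc).exists_injOn_of_encard_le
      (t := (Set.univ : Set (Fin M))) (by
        rw [Set.encard_univ, ENat.card_eq_coe_fintype_card, Fintype.card_fin]
        exact hc)
    exact ⟨s, hs⟩
  choose s hs using hball
  -- Labels that are not used by the ball in `Γ_n` are assigned the identity, so that every sequence
  -- still has length at most `K`.
  have hinv : ∀ n (k : Fin M), ∃ g : Γ n, D.len n g ≤ K ∧
      ((∃ g', D.len n g' ≤ K ∧ s n g' = k) → s n g = k) := by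
    intro n k
    by_cases h : ∃ g', D.len n g' ≤ K ∧ s n g' = k
    · obtain ⟨g, hg, hk⟩ := h
      exact ⟨g, hg, fun _ => hk⟩
    · exact ⟨1, by simp [D.len_one], fun h' => absurd h' h⟩
  choose e he he' using hinv
  refine ⟨M, fun k => ⟨fun n => e n k, K, fun n => he n k⟩, s, fun n g hg => ?_⟩
  exact hs n (he n _) hg (he' n _ ⟨g, hg, rfl⟩)

theorem exists_len_le_of_edist_le (D : GeneratingSystem Γ) {R : ℝ≥0} {x y : SepUnion D}
    (h : edist x y ≤ R) : ∃ g : Γ x.1, D.len x.1 g ≤ ⌊R⌋₊ ∧ y = ⟨x.1, x.2 * g⟩ := by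
  obtain ⟨n, a⟩ := x
  obtain ⟨m, b⟩ := y
  replace h : sepDist D ⟨n, a⟩ ⟨m, b⟩ ≤ R := h
  by_cases hnm : n = m
  · subst hnm
    rw [sepDist_same] at h
    exact ⟨a⁻¹ * b, Nat.le_floor (by exact_mod_cast h),
      congrArg (Sigma.mk n) (mul_inv_cancel_left a b).symm⟩
  · rw [sepDist_ne D hnm] at h
    simp at h

/-- Matrices of propagation at most `R` are combinations of finitely many translations, with
coefficients that are restrictions of the matrix. -/
theorem exists_decomposition (D : GeneratingSystem Γ) (R : ℝ≥0) :
    ∃ (M : ℕ) (γ : Fin M → boundedSeq D), ∀ T : uniformRoe (SepUnion D),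
      (∀ x y, entry T.1 x y ≠ 0 → edist x y ≤ R) →
      ∃ f : Fin M → EllInfty (SepUnion D), T = ∑ k, diag (f k) * transOp D (γ k) ∧
        (∀ k x, f k x = 0 ∨ f k x = entry T.1 x (rightMul D (γ k).1 x)) ∧
        ∀ k l x, f k x ≠ 0 → f l x ≠ 0 →
          rightMul D (γ k).1 x = rightMul D (γ l).1 x → k = l := by
  classical
  obtain ⟨M, γ, s, hs⟩ := exists_enumeration D ⌊R⌋₊
  refine ⟨M, γ, fun T hT => ?_⟩
  obtain ⟨C, hC⟩ := T.2.1
  -- Several of the sequences may pass through the same element of `Γ_n`. Only the one whose index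
  -- is the label of that element keeps the entry, so no entry is counted twice.
  let f : Fin M → EllInfty (SepUnion D) := fun k =>
    ⟨fun x => if s x.1 ((γ k).1 x.1) = k then entry T.1 x (rightMul D (γ k).1 x) else 0,
      memℓp_infty ⟨|C|, by
        rintro _ ⟨x, rfl⟩
        dsimp only
        split_ifs
        · exact (hC _ _).trans (le_abs_self C)
        · simp⟩⟩
  have hf : ∀ k x, f k x =
      if s x.1 ((γ k).1 x.1) = k then entry T.1 x (rightMul D (γ k).1 x) else 0 :=
    fun k x => rfl
  refine ⟨f, uniformRoe_ext fun x y => ?_, fun k x => ?_, fun k l x hk hl h => ?_⟩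
  · have hsum : entry (∑ k, diag (f k) * transOp D (γ k) : uniformRoe (SepUnion D)).1 x y
        = ∑ k, f k x * (if y = rightMul D (γ k).1 x then 1 else 0) := by
      have h1 : entry (∑ k, diag (f k) * transOp D (γ k) : uniformRoe (SepUnion D)).1 x y
          = ∑ k, entry (diag (f k) * transOp D (γ k) : uniformRoe (SepUnion D)).1 x y := by
        simp [entry, LinearMap.sum_apply, Finsupp.finsetSum_apply]
      rw [h1]
      refine Finset.sum_congr rfl fun k _ => ?_
      rw [entry_diag_mul, entry_transOp]
    rw [hsum]
    by_cases hxy : entry T.1 x y = 0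
    · rw [hxy, Finset.sum_eq_zero]
      intro k _
      split_ifs with h
      · rw [hf, ← h, hxy]
        simp
      · simp
    · obtain ⟨g, hg, hy⟩ := exists_len_le_of_edist_le D (hT x y hxy)
      have hk := hs x.1 g hg
      replace hy : y = rightMul D (γ (s x.1 g)).1 x := by
        rw [hy, rightMul, hk]
      rw [Finset.sum_eq_single (s x.1 g), hf, ← hy, if_pos rfl, mul_one, if_pos]
      · rw [hk]
      · intro k _ hne
        rw [hf]
        split_ifs with h1 h2
        · exfalso
          rw [hy, rightMul_eq_iff, hk] at h2
          rw [← h2] at h1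
          exact hne h1.symm
        all_goals simp
      · simp
  · rw [hf]
    split_ifs
    · exact Or.inr rfl
    · exact Or.inl rfl
  · rw [hf] at hk hl
    have hk' := (ite_ne_right_iff.1 hk).1
    have hl' := (ite_ne_right_iff.1 hl).1
    rw [rightMul_eq_iff] at h
    rw [← hk', ← hl', h]

theorem exists_sum_diag_mul_transOp (D : GeneratingSystem Γ) (T : uniformRoe (SepUnion D)) :
    ∃ (M : ℕ) (γ : Fin M → boundedSeq D) (f : Fin M → EllInfty (SepUnion D)),
      T = ∑ k, diag (f k) * transOp D (γ k) := by
  obtain ⟨R, hR⟩ := T.2.2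
  obtain ⟨M, γ, h⟩ := exists_decomposition D R
  obtain ⟨f, hf, -⟩ := h T hR
  exact ⟨M, γ, f, hf⟩

theorem exists_mul_eq_of_len_le (D : GeneratingSystem Γ) {n K : ℕ} {g : Γ n}
    (hg : D.len n g ≤ K + 1) : ∃ a b, a * b = g ∧ D.len n a ≤ 1 ∧ D.len n b ≤ K := by
  obtain ⟨L, hL, hLS, rfl⟩ := exists_min_word (D.symm n) (D.gen n) g
  rcases L with _ | ⟨s, L⟩
  · exact ⟨1, 1, by simp, by simp [D.len_one], by simp [D.len_one]⟩
  · refine ⟨s, L.prod, by simp, ?_, ?_⟩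
    · have := wordLength_le (S := D.S n) (L := [s]) (by simpa using hLS s (by simp))
      rwa [List.prod_singleton] at this
    · have := wordLength_le (S := D.S n) (L := L) (fun t ht => hLS t (by simp [ht]))
      refine this.trans ?_
      have h2 : wordLength (D.S n) (s :: L).prod ≤ K + 1 := hg
      rw [← hL, List.length_cons] at h2
      omega

/-- The limit group is finitely generated. -/
theorem fg_limitGroup (D : GeneratingSystem Γ) (ω : Ultrafilter ℕ) : Group.FG (LimitGroup D ω) := by
  obtain ⟨M, γ, s, hs⟩ := exists_enumeration D 1
  rw [Group.fg_iff]
  refine ⟨Set.range fun k => (QuotientGroup.mk (γ k) : LimitGroup D ω), ?_, Set.finite_range _⟩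
  set H := Subgroup.closure (Set.range fun k => (QuotientGroup.mk (γ k) : LimitGroup D ω))
  have h1 : ∀ δ : boundedSeq D, (∀ n, D.len n (δ.1 n) ≤ 1) →
      (QuotientGroup.mk δ : LimitGroup D ω) ∈ H := by
    intro δ hδ
    -- Pigeonhole for ultrafilters: the image of `ω` on a finite set is principal, so one label
    -- occurs `ω`-almost everywhere.
    obtain ⟨k, hk⟩ := (ω.map fun n => s n (δ.1 n)).eq_pure_of_finite
    have hk' : ∀ᶠ n in (ω : Filter ℕ), s n (δ.1 n) = k := by
      have : {k} ∈ ω.map fun n => s n (δ.1 n) := by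
        rw [hk]
        exact Set.mem_singleton k
      exact this
    have e : (QuotientGroup.mk (γ k) : LimitGroup D ω) = QuotientGroup.mk δ := by
      rw [mk_eq_mk_iff]
      filter_upwards [hk'] with n hn
      rw [← hn, hs n _ (hδ n)]
    rw [← e]
    exact Subgroup.subset_closure ⟨k, rfl⟩
  have h2 : ∀ (K : ℕ) (δ : boundedSeq D), (∀ n, D.len n (δ.1 n) ≤ K) →
      (QuotientGroup.mk δ : LimitGroup D ω) ∈ H := by
    intro K
    induction K with
    | zero => exact fun δ hδ => h1 δ fun n => (hδ n).trans zero_le_one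
    | succ K ih =>
      intro δ hδ
      -- A factor of length at most `1` is split off in every `Γ_n` simultaneously; both resulting
      -- sequences are bounded.
      choose a b hab ha hb using fun n => exists_mul_eq_of_len_le D (hδ n)
      let α : boundedSeq D := ⟨a, 1, ha⟩
      let β : boundedSeq D := ⟨b, K, hb⟩
      have e : δ = α * β := Subtype.ext (funext fun n => (hab n).symm)
      rw [e, QuotientGroup.mk_mul]
      exact H.mul_mem (h1 α ha) (ih β hb)
  rw [eq_top_iff]
  rintro g -
  induction g using QuotientGroup.induction_on with
  | H δ =>
    obtain ⟨K, hK⟩ := δ.2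
    exact h2 K δ hK

end Decomposition

/-! ### The measure preserving action on `Y` -/

section Action

variable {Γ : ℕ → Type u} [∀ n, Group (Γ n)]

instance (D : GeneratingSystem Γ) (ω : Ultrafilter ℕ) : CompactSpace (LimitSpectrum D ω) :=
  isCompact_iff_compactSpace.1 (isClosed_limitSpectrum D ω).isCompact

instance (D : GeneratingSystem Γ) (ω : Ultrafilter ℕ) : T2Space (LimitSpectrum D ω) :=
  inferInstanceAs (T2Space {χ : WeakDual.characterSpace ℂ (EllInfty (SepUnion D)) //
    ∀ f : EllInfty (SepUnion D), IsNull D ω f → χ f = 0})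

/-- The Gelfand transform of a bounded function, as a function on the spectrum at infinity. -/
def gelfand (D : GeneratingSystem Γ) (ω : Ultrafilter ℕ) :
    EllInfty (SepUnion D) →⋆ₐ[ℂ] C(LimitSpectrum D ω, ℂ) where
  toFun f := ⟨fun χ => χ.1 f, ((WeakDual.eval_continuous f).comp continuous_subtype_val).comp
    continuous_subtype_val⟩
  map_one' := ContinuousMap.ext fun χ => map_one χ.1
  map_mul' f g := ContinuousMap.ext fun χ => map_mul χ.1 f g
  map_zero' := ContinuousMap.ext fun χ => map_zero χ.1
  map_add' f g := ContinuousMap.ext fun χ => map_add χ.1 f g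
  commutes' c := ContinuousMap.ext fun χ => AlgHomClass.commutes χ.1 c
  map_star' f := ContinuousMap.ext fun χ => map_star χ.1 f

theorem gelfand_eq_zero (D : GeneratingSystem Γ) (ω : Ultrafilter ℕ)
    {f : EllInfty (SepUnion D)} (h : IsNull D ω f) : gelfand D ω f = 0 :=
  ContinuousMap.ext fun χ => χ.2 f h

theorem norm_gelfand_apply_le (D : GeneratingSystem Γ) (ω : Ultrafilter ℕ)
    (f : EllInfty (SepUnion D)) (χ : LimitSpectrum D ω) : ‖gelfand D ω f χ‖ ≤ ‖f‖ :=
  have : Nonempty (SepUnion D) := ⟨⟨0, 1⟩⟩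
  AlgHom.norm_apply_le_self (WeakDual.CharacterSpace.equivAlgHom χ.1) f

/-- Right multiplication permutes `Γ_n`, so the suprema do not change. This is why characters that
vanish on null functions are mapped to such characters. -/
theorem isNull_shift (D : GeneratingSystem Γ) (ω : Ultrafilter ℕ) (γ : ∀ n, Γ n)
    {f : EllInfty (SepUnion D)} (h : IsNull D ω f) : IsNull D ω (shift D γ f) := by
  refine h.congr fun n => ?_
  exact ((Equiv.mulRight (γ n)).iSup_comp (g := fun x : Γ n => ‖f ⟨n, x⟩‖)).symm

/-- The right action of sequences of group elements on the spectrum at infinity. -/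
def spectrumAct (D : GeneratingSystem Γ) (ω : Ultrafilter ℕ) (γ : ∀ n, Γ n)
    (χ : LimitSpectrum D ω) : LimitSpectrum D ω :=
  ⟨WeakDual.CharacterSpace.equivAlgHom.symm
    ((WeakDual.CharacterSpace.equivAlgHom χ.1).comp (shift D γ)),
    fun _ hf => χ.2 _ (isNull_shift D ω γ hf)⟩

theorem gelfand_spectrumAct (D : GeneratingSystem Γ) (ω : Ultrafilter ℕ) (γ : ∀ n, Γ n)
    (f : EllInfty (SepUnion D)) (χ : LimitSpectrum D ω) :
    gelfand D ω f (spectrumAct D ω γ χ) = gelfand D ω (shift D γ f) χ := rfl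

theorem limitSpectrum_ext (D : GeneratingSystem Γ) (ω : Ultrafilter ℕ) {χ ψ : LimitSpectrum D ω}
    (h : ∀ f, gelfand D ω f χ = gelfand D ω f ψ) : χ = ψ :=
  Subtype.ext (DFunLike.ext _ _ h)

theorem spectrumAct_mul (D : GeneratingSystem Γ) (ω : Ultrafilter ℕ) (γ δ : ∀ n, Γ n)
    (χ : LimitSpectrum D ω) :
    spectrumAct D ω (γ * δ) χ = spectrumAct D ω δ (spectrumAct D ω γ χ) := by
  refine limitSpectrum_ext D ω fun _ => ?_
  simp only [gelfand_spectrumAct, shift_shift]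

/-- A null sequence moves no point of `Γ_n` for `ω`-almost every `n`; hence `f` and its translate
differ by a null function, which no point of `Y` detects. -/
theorem spectrumAct_eq_self (D : GeneratingSystem Γ) (ω : Ultrafilter ℕ) {γ : boundedSeq D}
    (h : γ ∈ nullSeq D ω) (χ : LimitSpectrum D ω) : spectrumAct D ω γ.1 χ = χ := by
  refine limitSpectrum_ext D ω fun f => ?_
  rw [gelfand_spectrumAct, ← sub_eq_zero, ← ContinuousMap.sub_apply, ← map_sub,
    gelfand_eq_zero D ω, ContinuousMap.zero_apply]
  apply isNull_of_eventually
  have h' : (QuotientGroup.mk γ : LimitGroup D ω) = QuotientGroup.mk 1 :=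
    (QuotientGroup.eq_one_iff γ).2 h
  filter_upwards [(mk_eq_mk_iff D ω γ 1).1 h'] with n hn x hx
  subst hx
  have e : rightMul D γ.1 x = x := by
    rw [← rightMul_one D x, ← rightMul_mul, rightMul_eq_iff]
    simpa using hn
  rw [lp.coeFn_sub, Pi.sub_apply, shift_apply, e, sub_self]

theorem continuous_spectrumAct (D : GeneratingSystem Γ) (ω : Ultrafilter ℕ) (γ : ∀ n, Γ n) :
    Continuous (spectrumAct D ω γ) := by
  refine Continuous.subtype_mk (Continuous.subtype_mk ?_ _) _
  exact WeakDual.continuous_of_continuous_eval fun f => (gelfand D ω (shift D γ f)).continuous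

/-- The right action on the spectrum at infinity, as a homeomorphism. -/
def spectrumHomeo (D : GeneratingSystem Γ) (ω : Ultrafilter ℕ) (γ : ∀ n, Γ n) :
    LimitSpectrum D ω ≃ₜ LimitSpectrum D ω where
  toFun := spectrumAct D ω γ
  invFun := spectrumAct D ω γ⁻¹
  left_inv χ := by
    rw [← spectrumAct_mul, mul_inv_cancel]
    exact spectrumAct_eq_self D ω (γ := 1) (one_mem _) χ
  right_inv χ := by
    rw [← spectrumAct_mul, inv_mul_cancel]
    exact spectrumAct_eq_self D ω (γ := 1) (one_mem _) χ
  continuous_toFun := continuous_spectrumAct D ω γ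
  continuous_invFun := continuous_spectrumAct D ω γ⁻¹

/-- Stone–Weierstrass: points of `Y` are characters, so they are separated by elements of `ℓ^∞(X)`.
-/
theorem dense_range_gelfand (D : GeneratingSystem Γ) (ω : Ultrafilter ℕ) :
    DenseRange (gelfand D ω) := by
  have h := ContinuousMap.starSubalgebra_topologicalClosure_eq_top_of_separatesPoints
    (gelfand D ω).range (by
      intro χ ψ hne
      by_contra hcon
      push Not at hcon
      exact hne (limitSpectrum_ext D ω fun f => hcon _ ⟨gelfand D ω f, ⟨f, rfl⟩, rfl⟩))
  intro g
  have hg : g ∈ (gelfand D ω).range.topologicalClosure := by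
    rw [h]
    trivial
  exact hg

/-- Gelfand transforms are dense in `C(Y)` and integration is continuous there; regular measures
with equal integrals of continuous functions are equal. -/
theorem measure_eq_of_integral_gelfand (D : GeneratingSystem Γ) (ω : Ultrafilter ℕ)
    (μ ν : Measure (LimitSpectrum D ω)) [μ.Regular] [ν.Regular] [IsFiniteMeasure μ]
    [IsFiniteMeasure ν]
    (h : ∀ f, ∫ χ, gelfand D ω f χ ∂μ = ∫ χ, gelfand D ω f χ ∂ν) : μ = ν := by
  have hcont : ∀ (m : Measure (LimitSpectrum D ω)) [IsFiniteMeasure m],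
      Continuous fun g : C(LimitSpectrum D ω, ℂ) => ∫ χ, g χ ∂m := by
    intro m _
    -- Integration on `C(Y)` factors through the continuous maps `C(Y) → L¹ → ℂ`.
    have e : (fun g : C(LimitSpectrum D ω, ℂ) => ∫ χ, g χ ∂m) =
        fun g => ∫ χ, (ContinuousMap.toLp 1 m ℂ g) χ ∂m :=
      funext fun g => (integral_congr_ae (ContinuousMap.coeFn_toLp (p := 1) (𝕜 := ℂ) m g)).symm
    rw [e]
    exact continuous_integral.comp (ContinuousMap.toLp 1 m ℂ).continuous
  have hall : ∀ g : C(LimitSpectrum D ω, ℂ), ∫ χ, g χ ∂μ = ∫ χ, g χ ∂ν := fun g =>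
    congrFun ((dense_range_gelfand D ω).equalizer (hcont μ) (hcont ν) (funext h)) g
  refine Measure.ext_of_integral_eq_on_compactlySupported fun g => ?_
  have := hall ⟨fun χ => (g χ : ℂ), Complex.continuous_ofReal.comp g.continuous⟩
  simp only [ContinuousMap.coe_mk] at this
  rw [integral_complex_ofReal, integral_complex_ofReal] at this
  exact_mod_cast this

variable [∀ n, Fintype (Γ n)]

theorem avg_shift (D : GeneratingSystem Γ) (n : ℕ) (γ : ∀ n, Γ n) (f : EllInfty (SepUnion D)) :
    avg D n (shift D γ f) = avg D n f :=
  congrArg (· / (Fintype.card (Γ n) : ℂ))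
    (Equiv.sum_comp (Equiv.mulRight (γ n)) fun x : Γ n => f ⟨n, x⟩)

/-- Right translations preserve the measure that represents the limit state. -/
theorem measurePreserving_spectrumAct (D : GeneratingSystem Γ) (ω : Ultrafilter ℕ)
    {μ : Measure (LimitSpectrum D ω)} (hμ : RepresentsState D ω μ) (γ : ∀ n, Γ n) :
    MeasurePreserving (spectrumAct D ω γ) μ μ := by
  have := hμ.regular
  have := hμ.prob
  refine ⟨(continuous_spectrumAct D ω γ).measurable, ?_⟩
  -- Regularity of the image measure, needed for the uniqueness, holds because the action is by
  -- homeomorphisms.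
  have hreg : (μ.map (spectrumAct D ω γ)).Regular := Measure.Regular.map (spectrumHomeo D ω γ)
  have hfin : IsFiniteMeasure (μ.map (spectrumAct D ω γ)) := inferInstance
  refine measure_eq_of_integral_gelfand D ω _ _ fun f => ?_
  have e := (spectrumHomeo D ω γ).measurableEmbedding.integral_map (μ := μ) (gelfand D ω f)
  refine e.trans ?_
  show ∫ χ : LimitSpectrum D ω, χ.1 (shift D γ f) ∂μ = ∫ χ : LimitSpectrum D ω, χ.1 f ∂μ
  rw [← (hμ.integral_eq f).2, ← (hμ.integral_eq _).2, limState, limState]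
  simp only [avg_shift]

end Action

/-! ### Multiplication operators on `L^p(μ, B)` -/

section Multiplication

variable {Γ : ℕ → Type u} [∀ n, Group (Γ n)] {B : Type v} [NormedAddCommGroup B] [NormedSpace ℂ B]
  {p : ℝ≥0∞}

theorem aestronglyMeasurable_gelfand (D : GeneratingSystem Γ) (ω : Ultrafilter ℕ)
    (μ : Measure (LimitSpectrum D ω)) (f : EllInfty (SepUnion D)) :
    AEStronglyMeasurable (gelfand D ω f) μ :=
  (gelfand D ω f).continuous.aestronglyMeasurable

theorem memLp_gelfand_smul (D : GeneratingSystem Γ) (ω : Ultrafilter ℕ)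
    {μ : Measure (LimitSpectrum D ω)} (f : EllInfty (SepUnion D)) (ξ : Lp B p μ) :
    MemLp (fun χ => gelfand D ω f χ • ξ χ) p μ :=
  (Lp.memLp ξ).of_le_mul ((aestronglyMeasurable_gelfand D ω μ f).smul (Lp.aestronglyMeasurable ξ))
    (Filter.Eventually.of_forall fun χ => (norm_smul_le _ _).trans
      (mul_le_mul_of_nonneg_right (norm_gelfand_apply_le D ω f χ) (norm_nonneg _)))

variable [Fact (1 ≤ p)]

/-- Multiplication by the Gelfand transform of `f` on `L^p(μ, B)`. -/
def mulLpCLM (D : GeneratingSystem Γ) (ω : Ultrafilter ℕ) (μ : Measure (LimitSpectrum D ω))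
    (f : EllInfty (SepUnion D)) : Lp B p μ →L[ℂ] Lp B p μ :=
  LinearMap.mkContinuous
    { toFun := fun ξ => (memLp_gelfand_smul D ω f ξ).toLp _
      map_add' := by
        intro ξ η
        rw [← MemLp.toLp_add, MemLp.toLp_eq_toLp_iff]
        filter_upwards [Lp.coeFn_add ξ η] with χ h
        rw [h]
        exact smul_add _ _ _
      map_smul' := by
        intro c ξ
        rw [RingHom.id_apply, ← MemLp.toLp_const_smul, MemLp.toLp_eq_toLp_iff]
        filter_upwards [Lp.coeFn_smul c ξ] with χ h
        rw [h]
        exact smul_comm _ _ _ }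
    ‖f‖ (by
      intro ξ
      refine Lp.norm_le_mul_norm_of_ae_le_mul ?_
      filter_upwards [(memLp_gelfand_smul D ω f ξ).coeFn_toLp] with χ h
      refine (congrArg norm h).le.trans ((norm_smul_le _ _).trans ?_)
      exact mul_le_mul_of_nonneg_right (norm_gelfand_apply_le D ω f χ) (norm_nonneg _))

theorem coeFn_mulLpCLM (D : GeneratingSystem Γ) (ω : Ultrafilter ℕ)
    {μ : Measure (LimitSpectrum D ω)} (f : EllInfty (SepUnion D)) (ξ : Lp B p μ) :
    mulLpCLM D ω μ f ξ =ᵐ[μ] fun χ => gelfand D ω f χ • ξ χ :=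
  (memLp_gelfand_smul D ω f ξ).coeFn_toLp

theorem norm_mulLpCLM_le (D : GeneratingSystem Γ) (ω : Ultrafilter ℕ)
    (μ : Measure (LimitSpectrum D ω)) (f : EllInfty (SepUnion D)) :
    ‖(mulLpCLM D ω μ f : Lp B p μ →L[ℂ] Lp B p μ)‖ ≤ ‖f‖ :=
  LinearMap.mkContinuous_norm_le _ (norm_nonneg f) _

/-- The representation of `ℓ^∞(X)` on `L^p(μ, B)` by multiplication. -/
def mulLp (D : GeneratingSystem Γ) (ω : Ultrafilter ℕ) (μ : Measure (LimitSpectrum D ω)) :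
    EllInfty (SepUnion D) →ₐ[ℂ] (Lp B p μ →L[ℂ] Lp B p μ) :=
  AlgHom.ofLinearMap
    { toFun := mulLpCLM D ω μ
      map_add' := by
        intro f g
        ext1 ξ
        rw [add_apply]
        refine Lp.ext ?_
        filter_upwards [coeFn_mulLpCLM D ω (f + g) ξ, coeFn_mulLpCLM D ω f ξ,
          coeFn_mulLpCLM D ω g ξ, Lp.coeFn_add (mulLpCLM D ω μ f ξ) (mulLpCLM D ω μ g ξ)]
          with χ h1 h2 h3 h4
        rw [h4, Pi.add_apply, h1, h2, h3, map_add, ContinuousMap.add_apply, add_smul]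
      map_smul' := by
        intro c f
        ext1 ξ
        rw [RingHom.id_apply, smul_apply]
        refine Lp.ext ?_
        filter_upwards [coeFn_mulLpCLM D ω (c • f) ξ, coeFn_mulLpCLM D ω f ξ,
          Lp.coeFn_smul c (mulLpCLM D ω μ f ξ)] with χ h1 h2 h3
        rw [h3, Pi.smul_apply, h1, h2, map_smul, ContinuousMap.smul_apply, smul_assoc] }
    (by
      ext1 ξ
      refine Lp.ext ?_
      filter_upwards [coeFn_mulLpCLM D ω 1 ξ] with χ h
      refine h.trans ?_
      rw [map_one, ContinuousMap.one_apply, one_smul]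
      rfl)
    (by
      intro f g
      ext1 ξ
      refine Lp.ext ?_
      filter_upwards [coeFn_mulLpCLM D ω (f * g) ξ, coeFn_mulLpCLM D ω g ξ,
        coeFn_mulLpCLM D ω f (mulLpCLM D ω μ g ξ)] with χ h1 h2 h3
      refine h1.trans (Eq.trans ?_ h3.symm)
      rw [h2, map_mul, ContinuousMap.mul_apply, mul_smul])

theorem coeFn_mulLp (D : GeneratingSystem Γ) (ω : Ultrafilter ℕ)
    {μ : Measure (LimitSpectrum D ω)} (f : EllInfty (SepUnion D)) (ξ : Lp B p μ) :
    mulLp D ω μ f ξ =ᵐ[μ] fun χ => gelfand D ω f χ • ξ χ :=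
  coeFn_mulLpCLM D ω f ξ

theorem norm_mulLp_le (D : GeneratingSystem Γ) (ω : Ultrafilter ℕ)
    (μ : Measure (LimitSpectrum D ω)) (f : EllInfty (SepUnion D)) :
    ‖(mulLp D ω μ f : Lp B p μ →L[ℂ] Lp B p μ)‖ ≤ ‖f‖ :=
  norm_mulLpCLM_le D ω μ f

theorem mulLp_eq_zero (D : GeneratingSystem Γ) (ω : Ultrafilter ℕ)
    (μ : Measure (LimitSpectrum D ω)) {f : EllInfty (SepUnion D)} (h : IsNull D ω f) :
    (mulLp D ω μ f : Lp B p μ →L[ℂ] Lp B p μ) = 0 := by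
  ext1 ξ
  refine Lp.ext ?_
  filter_upwards [coeFn_mulLp D ω f ξ,
    Lp.coeFn_zero (E := B) (p := p) (μ := μ)] with χ h1 h2
  rw [h1, gelfand_eq_zero D ω h, ContinuousMap.zero_apply, zero_smul]
  exact h2.symm

end Multiplication

/-! ### The induced homomorphism of the Roe algebra -/

section Representation

variable {Γ : ℕ → Type u} [∀ n, Group (Γ n)] [∀ n, Fintype (Γ n)]
  {B : Type v} [NormedAddCommGroup B] [NormedSpace ℂ B] {p : ℝ≥0∞} [Fact (1 ≤ p)]

/-- The operator `(λ_γ ξ)(χ) = ρ(γ) ξ(χ·γ)` on `L^p(μ, B)`. -/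
def transLp (D : GeneratingSystem Γ) (ω : Ultrafilter ℕ) {μ : Measure (LimitSpectrum D ω)}
    (hμ : RepresentsState D ω μ) (ρ : LimitGroup D ω →* (B ≃ₗᵢ[ℂ] B)) (γ : boundedSeq D) :
    Lp B p μ →L[ℂ] Lp B p μ :=
  (((ρ (QuotientGroup.mk γ)).toContinuousLinearEquiv : B →L[ℂ] B).compLpL p μ).comp
    (Lp.compMeasurePreservingₗᵢ ℂ (spectrumAct D ω γ.1)
      (measurePreserving_spectrumAct D ω hμ γ.1)).toContinuousLinearMap

theorem coeFn_transLp (D : GeneratingSystem Γ) (ω : Ultrafilter ℕ)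
    {μ : Measure (LimitSpectrum D ω)} (hμ : RepresentsState D ω μ)
    (ρ : LimitGroup D ω →* (B ≃ₗᵢ[ℂ] B)) (γ : boundedSeq D) (ξ : Lp B p μ) :
    transLp D ω hμ ρ γ ξ =ᵐ[μ]
      fun χ => ρ (QuotientGroup.mk γ) (ξ (spectrumAct D ω γ.1 χ)) := by
  have hmp := measurePreserving_spectrumAct D ω hμ γ.1
  filter_upwards [ContinuousLinearMap.coeFn_compLpL
    ((ρ (QuotientGroup.mk γ)).toContinuousLinearEquiv : B →L[ℂ] B)
    (Lp.compMeasurePreserving (spectrumAct D ω γ.1) hmp ξ),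
    Lp.coeFn_compMeasurePreserving ξ hmp] with χ h1 h2
  refine h1.trans ?_
  rw [h2]
  rfl

theorem transLp_mul (D : GeneratingSystem Γ) (ω : Ultrafilter ℕ)
    {μ : Measure (LimitSpectrum D ω)} (hμ : RepresentsState D ω μ)
    (ρ : LimitGroup D ω →* (B ≃ₗᵢ[ℂ] B)) (γ δ : boundedSeq D) :
    (transLp D ω hμ ρ (γ * δ) : Lp B p μ →L[ℂ] Lp B p μ) =
      transLp D ω hμ ρ γ * transLp D ω hμ ρ δ := by
  ext1 ξ
  refine Lp.ext ?_
  have hmp := measurePreserving_spectrumAct D ω hμ γ.1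
  filter_upwards [coeFn_transLp D ω hμ ρ (γ * δ) ξ,
    coeFn_transLp D ω hμ ρ γ (transLp D ω hμ ρ δ ξ),
    hmp.quasiMeasurePreserving.ae (coeFn_transLp D ω hμ ρ δ ξ)] with χ h1 h2 h3
  refine h1.trans (Eq.trans ?_ h2.symm)
  rw [h3, QuotientGroup.mk_mul, map_mul, ← spectrumAct_mul]
  rfl

theorem transLp_eq_one (D : GeneratingSystem Γ) (ω : Ultrafilter ℕ)
    {μ : Measure (LimitSpectrum D ω)} (hμ : RepresentsState D ω μ)
    (ρ : LimitGroup D ω →* (B ≃ₗᵢ[ℂ] B)) {γ : boundedSeq D} (hγ : γ ∈ nullSeq D ω) :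
    (transLp D ω hμ ρ γ : Lp B p μ →L[ℂ] Lp B p μ) = 1 := by
  ext1 ξ
  refine Lp.ext ?_
  filter_upwards [coeFn_transLp D ω hμ ρ γ ξ] with χ h1
  refine h1.trans ?_
  rw [spectrumAct_eq_self D ω hγ, (QuotientGroup.eq_one_iff γ).2 hγ, map_one]
  rfl

/-- The representation of the limit group on `L^p(μ, B)`. -/
def groupLp (D : GeneratingSystem Γ) (ω : Ultrafilter ℕ) {μ : Measure (LimitSpectrum D ω)}
    (hμ : RepresentsState D ω μ) (ρ : LimitGroup D ω →* (B ≃ₗᵢ[ℂ] B)) :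
    LimitGroup D ω →* (Lp B p μ →L[ℂ] Lp B p μ) :=
  QuotientGroup.lift (nullSeq D ω)
    { toFun := transLp D ω hμ ρ
      map_one' := transLp_eq_one D ω hμ ρ (one_mem _)
      map_mul' := transLp_mul D ω hμ ρ }
    fun _ hγ => transLp_eq_one D ω hμ ρ hγ

theorem coeFn_groupLp (D : GeneratingSystem Γ) (ω : Ultrafilter ℕ)
    {μ : Measure (LimitSpectrum D ω)} (hμ : RepresentsState D ω μ)
    (ρ : LimitGroup D ω →* (B ≃ₗᵢ[ℂ] B)) (γ : boundedSeq D) (ξ : Lp B p μ) :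
    groupLp D ω hμ ρ (QuotientGroup.mk γ) ξ =ᵐ[μ]
      fun χ => ρ (QuotientGroup.mk γ) (ξ (spectrumAct D ω γ.1 χ)) :=
  coeFn_transLp D ω hμ ρ γ ξ

/-- The counterpart on `L^p(μ, B)` of `transOp_mul_diag`; the scalar factor passes through the
linear map `ρ(g)`. -/
theorem groupLp_mul_mulLp (D : GeneratingSystem Γ) (ω : Ultrafilter ℕ)
    {μ : Measure (LimitSpectrum D ω)} (hμ : RepresentsState D ω μ)
    (ρ : LimitGroup D ω →* (B ≃ₗᵢ[ℂ] B)) (γ : boundedSeq D) (f : EllInfty (SepUnion D)) :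
    (groupLp D ω hμ ρ (QuotientGroup.mk γ) * mulLp D ω μ f : Lp B p μ →L[ℂ] Lp B p μ) =
      mulLp D ω μ (shift D γ.1 f) * groupLp D ω hμ ρ (QuotientGroup.mk γ) := by
  ext1 ξ
  refine Lp.ext ?_
  have hmp := measurePreserving_spectrumAct D ω hμ γ.1
  filter_upwards [coeFn_groupLp D ω hμ ρ γ (mulLp D ω μ f ξ),
    coeFn_mulLp D ω (shift D γ.1 f) (groupLp D ω hμ ρ (QuotientGroup.mk γ) ξ),
    hmp.quasiMeasurePreserving.ae (coeFn_mulLp D ω f ξ),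
    coeFn_groupLp D ω hμ ρ γ ξ] with χ h1 h2 h3 h4
  refine h1.trans (Eq.trans ?_ h2.symm)
  rw [h3, h4, map_smul, gelfand_spectrumAct]

/-- The component at `g` of the operator on `L^p(μ, B)` given by a matrix. -/
def roeComponent (D : GeneratingSystem Γ) (ω : Ultrafilter ℕ) {μ : Measure (LimitSpectrum D ω)}
    (hμ : RepresentsState D ω μ) (ρ : LimitGroup D ω →* (B ≃ₗᵢ[ℂ] B)) (g : LimitGroup D ω) :
    uniformRoe (SepUnion D) →ₗ[ℂ] (Lp B p μ →L[ℂ] Lp B p μ) :=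
  (LinearMap.mulRight ℂ (groupLp D ω hμ ρ g)).comp
    ((mulLp D ω μ).toLinearMap.comp (coefficient D g.out))

theorem roeComponent_apply (D : GeneratingSystem Γ) (ω : Ultrafilter ℕ)
    {μ : Measure (LimitSpectrum D ω)} (hμ : RepresentsState D ω μ)
    (ρ : LimitGroup D ω →* (B ≃ₗᵢ[ℂ] B)) (g : LimitGroup D ω) (T : uniformRoe (SepUnion D)) :
    (roeComponent D ω hμ ρ g T : Lp B p μ →L[ℂ] Lp B p μ) =
      mulLp D ω μ (coefficient D g.out T) * groupLp D ω hμ ρ g := rfl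

theorem roeComponent_of_ne (D : GeneratingSystem Γ) (ω : Ultrafilter ℕ)
    {μ : Measure (LimitSpectrum D ω)} (hμ : RepresentsState D ω μ)
    (ρ : LimitGroup D ω →* (B ≃ₗᵢ[ℂ] B)) {g : LimitGroup D ω} {γ : boundedSeq D}
    (h : g ≠ QuotientGroup.mk γ) (f : EllInfty (SepUnion D)) :
    (roeComponent D ω hμ ρ g (diag f * transOp D γ) : Lp B p μ →L[ℂ] Lp B p μ) = 0 := by
  rw [roeComponent_apply, mulLp_eq_zero, zero_mul]
  apply isNull_coefficient
  rw [QuotientGroup.out_eq']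
  exact h.symm

/-- The component uses the chosen representative `g.out` instead of `γ`; the two coefficients differ
by a null function, on which `mulLp` vanishes. -/
theorem roeComponent_mk (D : GeneratingSystem Γ) (ω : Ultrafilter ℕ)
    {μ : Measure (LimitSpectrum D ω)} (hμ : RepresentsState D ω μ)
    (ρ : LimitGroup D ω →* (B ≃ₗᵢ[ℂ] B)) (γ : boundedSeq D) (f : EllInfty (SepUnion D)) :
    (roeComponent D ω hμ ρ (QuotientGroup.mk γ) (diag f * transOp D γ) :
      Lp B p μ →L[ℂ] Lp B p μ) =
      mulLp D ω μ f * groupLp D ω hμ ρ (QuotientGroup.mk γ) := by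
  rw [roeComponent_apply]
  congr 1
  rw [← sub_eq_zero, ← map_sub]
  apply mulLp_eq_zero
  apply isNull_coefficient_sub
  exact (QuotientGroup.out_eq' _).symm

/-- Only the classes of the translations in a finite decomposition contribute. This legitimizes the
`finsum` in `roeLinear`, which would otherwise default to `0`. -/
theorem finite_support_roeComponent (D : GeneratingSystem Γ) (ω : Ultrafilter ℕ)
    {μ : Measure (LimitSpectrum D ω)} (hμ : RepresentsState D ω μ)
    (ρ : LimitGroup D ω →* (B ≃ₗᵢ[ℂ] B)) (T : uniformRoe (SepUnion D)) :
    (Function.support fun g =>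
      (roeComponent D ω hμ ρ g T : Lp B p μ →L[ℂ] Lp B p μ)).Finite := by
  obtain ⟨M, γ, f, rfl⟩ := exists_sum_diag_mul_transOp D T
  refine (Set.finite_range fun k => (QuotientGroup.mk (γ k) : LimitGroup D ω)).subset ?_
  intro g hg
  by_contra hcon
  refine hg ?_
  show roeComponent D ω hμ ρ g _ = 0
  rw [map_sum]
  refine Finset.sum_eq_zero fun k _ => roeComponent_of_ne D ω hμ ρ (fun h => hcon ?_) _
  exact ⟨k, h.symm⟩

/-- The linear map underlying the representation of the uniform Roe algebra on `L^p(μ, B)`. -/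
def roeLinear (D : GeneratingSystem Γ) (ω : Ultrafilter ℕ) {μ : Measure (LimitSpectrum D ω)}
    (hμ : RepresentsState D ω μ) (ρ : LimitGroup D ω →* (B ≃ₗᵢ[ℂ] B)) :
    uniformRoe (SepUnion D) →ₗ[ℂ] (Lp B p μ →L[ℂ] Lp B p μ) where
  toFun T := ∑ᶠ g, roeComponent D ω hμ ρ g T
  map_add' T S := by
    simp only [map_add]
    exact finsum_add_distrib (finite_support_roeComponent D ω hμ ρ T)
      (finite_support_roeComponent D ω hμ ρ S)
  map_smul' c T := by
    simp only [map_smul, RingHom.id_apply]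
    exact (smul_finsum' c (finite_support_roeComponent D ω hμ ρ T)).symm

theorem roeLinear_diag_mul_transOp (D : GeneratingSystem Γ) (ω : Ultrafilter ℕ)
    {μ : Measure (LimitSpectrum D ω)} (hμ : RepresentsState D ω μ)
    (ρ : LimitGroup D ω →* (B ≃ₗᵢ[ℂ] B)) (f : EllInfty (SepUnion D)) (γ : boundedSeq D) :
    (roeLinear D ω hμ ρ (diag f * transOp D γ) : Lp B p μ →L[ℂ] Lp B p μ) =
      mulLp D ω μ f * groupLp D ω hμ ρ (QuotientGroup.mk γ) := by
  show ∑ᶠ g, roeComponent D ω hμ ρ g _ = _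
  rw [finsum_eq_single _ (QuotientGroup.mk γ) fun g hg => roeComponent_of_ne D ω hμ ρ hg f,
    roeComponent_mk]

/-- The homomorphism of the uniform Roe algebra to the operators on `L^p(μ, B)` determined by a
linear isometric representation of the limit group on `B`. -/
def roeAlgHom (D : GeneratingSystem Γ) (ω : Ultrafilter ℕ) {μ : Measure (LimitSpectrum D ω)}
    (hμ : RepresentsState D ω μ) (ρ : LimitGroup D ω →* (B ≃ₗᵢ[ℂ] B)) :
    uniformRoe (SepUnion D) →ₐ[ℂ] (Lp B p μ →L[ℂ] Lp B p μ) :=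
  AlgHom.ofLinearMap (roeLinear D ω hμ ρ)
    (by
      have h := roeLinear_diag_mul_transOp (B := B) (p := p) D ω hμ ρ 1 1
      rwa [diag_one, transOp_one, mul_one, map_one (mulLp D ω μ), QuotientGroup.mk_one,
        map_one (groupLp D ω hμ ρ), mul_one] at h)
    (by
      intro T S
      obtain ⟨M, γ, f, rfl⟩ := exists_sum_diag_mul_transOp D T
      obtain ⟨N, δ, h, rfl⟩ := exists_sum_diag_mul_transOp D S
      simp only [Finset.sum_mul_sum, map_sum]
      refine Finset.sum_congr rfl fun i _ => Finset.sum_congr rfl fun j _ => ?_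
      -- The crossed product rule `(f V_γ)(h V_δ) = f (γ·h) V_{γδ}`; the operators `M_f λ_g` obey
      -- the same rule.
      have e : diag (f i) * transOp D (γ i) * (diag (h j) * transOp D (δ j)) =
          diag (f i * shift D (γ i).1 (h j)) * transOp D (γ i * δ j) := by
        rw [← diag_mul_diag, ← transOp_mul, mul_assoc, ← mul_assoc (transOp D (γ i)),
          transOp_mul_diag]
        simp only [mul_assoc]
      rw [e, roeLinear_diag_mul_transOp, roeLinear_diag_mul_transOp, roeLinear_diag_mul_transOp,
        map_mul, QuotientGroup.mk_mul, map_mul, mul_assoc, mul_assoc,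
        ← mul_assoc (groupLp D ω hμ ρ (QuotientGroup.mk (γ i))), groupLp_mul_mulLp, mul_assoc])

theorem roeAlgHom_diag_mul_transOp (D : GeneratingSystem Γ) (ω : Ultrafilter ℕ)
    {μ : Measure (LimitSpectrum D ω)} (hμ : RepresentsState D ω μ)
    (ρ : LimitGroup D ω →* (B ≃ₗᵢ[ℂ] B)) (f : EllInfty (SepUnion D)) (γ : boundedSeq D) :
    (roeAlgHom D ω hμ ρ (diag f * transOp D γ) : Lp B p μ →L[ℂ] Lp B p μ) =
      mulLp D ω μ f * groupLp D ω hμ ρ (QuotientGroup.mk γ) :=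
  roeLinear_diag_mul_transOp D ω hμ ρ f γ

theorem roeAlgHom_diag (D : GeneratingSystem Γ) (ω : Ultrafilter ℕ)
    {μ : Measure (LimitSpectrum D ω)} (hμ : RepresentsState D ω μ)
    (ρ : LimitGroup D ω →* (B ≃ₗᵢ[ℂ] B)) (f : EllInfty (SepUnion D)) :
    (roeAlgHom D ω hμ ρ (diag f) : Lp B p μ →L[ℂ] Lp B p μ) = mulLp D ω μ f := by
  have h := roeAlgHom_diag_mul_transOp (B := B) (p := p) D ω hμ ρ f 1
  rwa [transOp_one, mul_one, QuotientGroup.mk_one, map_one, mul_one] at h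

end Representation

/-! ### Partial translations act as contractions; the induced representation and its defects -/

section Contractive

variable {Γ : ℕ → Type u} [∀ n, Group (Γ n)] [∀ n, Fintype (Γ n)]
  {B : Type v} [NormedAddCommGroup B] [NormedSpace ℂ B] {p : ℝ≥0∞} [Fact (1 ≤ p)]

/-- At most one of finitely many orthogonal idempotents is nonzero at a given point, and its value
there is `1`. -/
theorem eq_zero_or_exists_eq_one_of_orthogonal {ι : Type*} {a : ι → ℂ}
    (hidem : ∀ k, a k * a k = a k) (horth : ∀ k l, k ≠ l → a k * a l = 0) :
    (∀ k, a k = 0) ∨ ∃ k, a k = 1 ∧ ∀ l, l ≠ k → a l = 0 := by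
  by_cases h : ∃ k, a k ≠ 0
  · obtain ⟨k, hk⟩ := h
    exact Or.inr ⟨k, mul_left_cancel₀ hk (by rw [hidem, mul_one]),
      fun l hl => (mul_eq_zero.1 (horth l k hl)).resolve_right hk⟩
  · push Not at h
    exact Or.inl h

theorem sum_enorm_le_one_of_orthogonal {ι : Type*} [Fintype ι] {a : ι → ℂ}
    (hidem : ∀ k, a k * a k = a k) (horth : ∀ k l, k ≠ l → a k * a l = 0) :
    ∑ k, ‖a k‖ₑ ≤ 1 := by
  rcases eq_zero_or_exists_eq_one_of_orthogonal hidem horth with h | ⟨k, hk, h⟩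
  · simp [h]
  · rw [Finset.sum_eq_single k (fun l _ hl => by simp [h l hl]) (by simp), hk]
    simp

/-- At most one summand survives, with coefficient `1`, so the power can be taken term by term. -/
theorem enorm_sum_smul_rpow_le_of_orthogonal {ι : Type*} [Fintype ι] {a : ι → ℂ} {r : ℝ}
    (hr : 0 < r) (hidem : ∀ k, a k * a k = a k) (horth : ∀ k l, k ≠ l → a k * a l = 0)
    (b : ι → B) : ‖∑ k, a k • b k‖ₑ ^ r ≤ ∑ k, ‖a k‖ₑ * ‖b k‖ₑ ^ r := by
  rcases eq_zero_or_exists_eq_one_of_orthogonal hidem horth with h | ⟨k, hk, h⟩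
  · simp [h, hr]
  · rw [Finset.sum_eq_single k (fun l _ hl => by simp [h l hl]) (by simp),
      Finset.sum_eq_single k (fun l _ hl => by simp [h l hl]) (by simp), hk]
    simp

/-- Partial translations act as contractions on `L^p(μ, B)`. -/
theorem norm_sum_mulLp_mul_groupLp_le (D : GeneratingSystem Γ) (ω : Ultrafilter ℕ)
    {μ : Measure (LimitSpectrum D ω)} (hμ : RepresentsState D ω μ)
    (ρ : LimitGroup D ω →* (B ≃ₗᵢ[ℂ] B)) (hp : p ≠ ∞) {M : ℕ} (γ : Fin M → boundedSeq D)
    (f : Fin M → EllInfty (SepUnion D)) (hidem : ∀ k, f k * f k = f k)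
    (horth : ∀ k l, k ≠ l → f k * f l = 0)
    (horth' : ∀ k l, k ≠ l →
      shift D (γ k)⁻¹.1 (f k) * shift D (γ l)⁻¹.1 (f l) = 0) :
    ‖(∑ k, mulLp D ω μ (f k) * groupLp D ω hμ ρ (QuotientGroup.mk (γ k)) :
      Lp B p μ →L[ℂ] Lp B p μ)‖ ≤ 1 := by
  refine ContinuousLinearMap.opNorm_le_bound _ zero_le_one fun ξ => ?_
  rw [one_mul]
  have hp0 : p ≠ 0 := (zero_lt_one.trans_le (Fact.out : 1 ≤ p)).ne'
  have hr : 0 < p.toReal := ENNReal.toReal_pos hp0 hp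
  set η : Lp B p μ := (∑ k, mulLp D ω μ (f k) * groupLp D ω hμ ρ (QuotientGroup.mk (γ k)) :
      Lp B p μ →L[ℂ] Lp B p μ) ξ with hη
  have hae : η =ᵐ[μ] fun χ => ∑ k, gelfand D ω (f k) χ •
      ρ (QuotientGroup.mk (γ k)) (ξ (spectrumAct D ω (γ k).1 χ)) := by
    have e : η = ∑ k, mulLp D ω μ (f k) (groupLp D ω hμ ρ (QuotientGroup.mk (γ k)) ξ) := by
      rw [hη, sum_apply]
      rfl
    have h1 : ∀ᵐ χ ∂μ, ∀ k, mulLp D ω μ (f k) (groupLp D ω hμ ρ (QuotientGroup.mk (γ k)) ξ) χ =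
        gelfand D ω (f k) χ • ρ (QuotientGroup.mk (γ k)) (ξ (spectrumAct D ω (γ k).1 χ)) := by
      refine ae_all_iff.2 fun k => ?_
      filter_upwards [coeFn_mulLp D ω (f k) (groupLp D ω hμ ρ (QuotientGroup.mk (γ k)) ξ),
        coeFn_groupLp D ω hμ ρ (γ k) ξ] with χ h1 h2
      rw [h1, h2]
    rw [e]
    filter_upwards [Lp.coeFn_fun_finsetSum Finset.univ fun k =>
      mulLp D ω μ (f k) (groupLp D ω hμ ρ (QuotientGroup.mk (γ k)) ξ), h1] with χ h2 h3
    rw [h2]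
    exact Finset.sum_congr rfl fun k _ => h3 k
  have hg : ∀ (f : Fin M → EllInfty (SepUnion D)) (h : ∀ k l, k ≠ l → f k * f l = 0)
      (χ : LimitSpectrum D ω) (k l), k ≠ l → gelfand D ω (f k) χ * gelfand D ω (f l) χ = 0 := by
    intro f h χ k l hkl
    rw [← ContinuousMap.mul_apply, ← map_mul, h k l hkl, map_zero, ContinuousMap.zero_apply]
  have hi : ∀ (f : Fin M → EllInfty (SepUnion D)) (h : ∀ k, f k * f k = f k)
      (χ : LimitSpectrum D ω) (k), gelfand D ω (f k) χ * gelfand D ω (f k) χ =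
        gelfand D ω (f k) χ := by
    intro f h χ k
    rw [← ContinuousMap.mul_apply, ← map_mul, h k]
  have hmeas : ∀ f : EllInfty (SepUnion D), Measurable fun χ => ‖gelfand D ω f χ‖ₑ := fun f =>
    (gelfand D ω f).continuous.measurable.enorm
  have key : eLpNorm η p μ ≤ eLpNorm ξ p μ := by
    rw [eLpNorm_congr_ae hae, eLpNorm_eq_lintegral_rpow_enorm_toReal hp0 hp,
      eLpNorm_eq_lintegral_rpow_enorm_toReal hp0 hp]
    refine ENNReal.rpow_le_rpow ?_ (by positivity)
    calc ∫⁻ χ, ‖∑ k, gelfand D ω (f k) χ •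
          ρ (QuotientGroup.mk (γ k)) (ξ (spectrumAct D ω (γ k).1 χ))‖ₑ ^ p.toReal ∂μ
        ≤ ∫⁻ χ, ∑ k, ‖gelfand D ω (f k) χ‖ₑ *
            ‖ξ (spectrumAct D ω (γ k).1 χ)‖ₑ ^ p.toReal ∂μ := by
          refine lintegral_mono fun χ => ?_
          refine (enorm_sum_smul_rpow_le_of_orthogonal hr (hi f hidem χ) (hg f horth χ) _).trans ?_
          simp only [LinearIsometryEquiv.enorm_map]
          exact le_rfl
      _ = ∑ k, ∫⁻ χ, ‖gelfand D ω (f k) χ‖ₑ *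
            ‖ξ (spectrumAct D ω (γ k).1 χ)‖ₑ ^ p.toReal ∂μ := by
          refine lintegral_finsetSum' _ fun k _ => ?_
          refine (hmeas (f k)).aemeasurable.mul (AEMeasurable.pow_const ?_ _)
          exact ((Lp.aestronglyMeasurable ξ).comp_measurePreserving
            (measurePreserving_spectrumAct D ω hμ (γ k).1)).enorm
      -- The invariant change of variables `χ ↦ χ·γ_k` moves the translation from `ξ` to `f_k`,
      -- which becomes the idempotent of the image of the `k`-th piece.
      _ = ∑ k, ∫⁻ χ, ‖gelfand D ω (shift D (γ k)⁻¹.1 (f k)) χ‖ₑ * ‖ξ χ‖ₑ ^ p.toReal ∂μ := by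
          refine Finset.sum_congr rfl fun k _ => ?_
          rw [← (measurePreserving_spectrumAct D ω hμ (γ k).1).lintegral_comp_emb
            (spectrumHomeo D ω (γ k).1).measurableEmbedding
            fun χ => ‖gelfand D ω (shift D (γ k)⁻¹.1 (f k)) χ‖ₑ * ‖ξ χ‖ₑ ^ p.toReal]
          refine lintegral_congr fun χ => ?_
          rw [gelfand_spectrumAct, shift_shift]
          have e : (γ k).1 * (γ k)⁻¹.1 = 1 := mul_inv_cancel (γ k).1
          rw [e, shift_one]
      _ = ∫⁻ χ, ∑ k, ‖gelfand D ω (shift D (γ k)⁻¹.1 (f k)) χ‖ₑ * ‖ξ χ‖ₑ ^ p.toReal ∂μ := by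
          refine (lintegral_finsetSum' _ fun k _ => ?_).symm
          exact (hmeas _).aemeasurable.mul
            ((Lp.aestronglyMeasurable ξ).enorm.pow_const _)
      -- The images of the pieces are disjoint, so their idempotents add up to at most `1`.
      _ ≤ ∫⁻ χ, ‖ξ χ‖ₑ ^ p.toReal ∂μ := by
          refine lintegral_mono fun χ => ?_
          rw [← Finset.sum_mul]
          refine (mul_le_mul_left (sum_enorm_le_one_of_orthogonal
            (hi (fun k => shift D (γ k)⁻¹.1 (f k)) (fun k => ?_) χ)
            (hg (fun k => shift D (γ k)⁻¹.1 (f k)) horth' χ)) _).trans (one_mul _).le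
          rw [← map_mul, hidem]
  rw [Lp.norm_def, Lp.norm_def]
  exact ENNReal.toReal_mono (Lp.eLpNorm_ne_top ξ) key

theorem norm_le_of_apply_norm_le {X : Type u} (f : EllInfty X) {C : ℝ} (hC : 0 ≤ C)
    (h : ∀ x, ‖f x‖ ≤ C) : ‖f‖ ≤ C :=
  lp.norm_le_of_forall_le hC h

/-- The coefficients of a partial translation are indicator functions. Their supports are disjoint
because each row has at most one entry, and the translated supports are disjoint because each column
has at most one. -/
theorem norm_roeAlgHom_partialTranslation_le (D : GeneratingSystem Γ) (ω : Ultrafilter ℕ)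
    {μ : Measure (LimitSpectrum D ω)} (hμ : RepresentsState D ω μ)
    (ρ : LimitGroup D ω →* (B ≃ₗᵢ[ℂ] B)) (hp : p ≠ ∞) {V : uniformRoe (SepUnion D)}
    (hV : IsPartialTranslation V) :
    ‖(roeAlgHom D ω hμ ρ V : Lp B p μ →L[ℂ] Lp B p μ)‖ ≤ 1 := by
  obtain ⟨R, hR⟩ := V.2.2
  obtain ⟨M, γ, hγ⟩ := exists_decomposition D R
  obtain ⟨f, hf, hval, hinj⟩ := hγ V hR
  have hsupp : ∀ k x, f k x ≠ 0 → (x, rightMul D (γ k).1 x) ∈ supp V := by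
    intro k x h
    show entry V.1 x _ ≠ 0
    rwa [← (hval k x).resolve_left h]
  have key : (roeAlgHom D ω hμ ρ V : Lp B p μ →L[ℂ] Lp B p μ) =
      ∑ k, mulLp D ω μ (f k) * groupLp D ω hμ ρ (QuotientGroup.mk (γ k)) := by
    rw [hf, map_sum]
    exact Finset.sum_congr rfl fun k _ => roeAlgHom_diag_mul_transOp D ω hμ ρ _ _
  rw [key]
  refine norm_sum_mulLp_mul_groupLp_le D ω hμ ρ hp γ f (fun k => ?_) (fun k l hkl => ?_)
    fun k l hkl => ?_
  · ext x
    show f k x * f k x = f k x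
    rcases hval k x with h | h
    · simp [h]
    · rcases hV.zero_or_one x (rightMul D (γ k).1 x) with h' | h' <;> simp [h, h']
  · ext x
    show f k x * f l x = 0
    by_contra hne
    have hk := left_ne_zero_of_mul hne
    have hl := right_ne_zero_of_mul hne
    exact hkl (hinj k l x hk hl (hV.row x _ _ (hsupp k x hk) (hsupp l x hl)))
  · ext x
    show f k (rightMul D (γ k)⁻¹.1 x) * f l (rightMul D (γ l)⁻¹.1 x) = 0
    by_contra hne
    have hk := left_ne_zero_of_mul hne
    have hl := right_ne_zero_of_mul hne
    have hback : ∀ i, rightMul D (γ i).1 (rightMul D (γ i)⁻¹.1 x) = x := by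
      intro i
      rw [← rightMul_mul]
      have e : (γ i)⁻¹.1 * (γ i).1 = 1 := inv_mul_cancel (γ i).1
      rw [e, rightMul_one]
    have hk' := hsupp k _ hk
    have hl' := hsupp l _ hl
    rw [hback] at hk' hl'
    have e := hV.col _ _ x hk' hl'
    rw [← e] at hl
    -- Both pieces start at the same row and end at `x`, so the uniqueness of labels forces `k = l`.
    exact hkl (hinj k l _ hk hl ((hback k).trans (by rw [e, hback l])))

/-- The representation of the uniform Roe algebra on `L^p(μ, B)` determined by a linear isometric
representation of the limit group on `B`. -/
def inducedRep (D : GeneratingSystem Γ) (ω : Ultrafilter ℕ) {μ : Measure (LimitSpectrum D ω)}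
    (hμ : RepresentsState D ω μ) (hp : p ≠ ∞) (ρ : LimitGroup D ω →* (B ≃ₗᵢ[ℂ] B)) :
    RoeRep (SepUnion D) (Lp B p μ) where
  toAlgHom := roeAlgHom D ω hμ ρ
  contractive T := by
    refine le_csInf ?_ ?_
    -- A decomposition exists; otherwise the real infimum would default to `0`.
    · obtain ⟨M, γ, f, hT⟩ := exists_sum_diag_mul_transOp D T
      exact ⟨_, M, f, fun k => transOp D (γ k),
        fun k => isPartialTranslation_transOp D (γ k), hT, rfl⟩
    · rintro _ ⟨N, f, V, hV, rfl, rfl⟩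
      rw [map_sum]
      refine norm_sum_le_of_le _ fun k _ => ?_
      rw [map_mul, roeAlgHom_diag]
      calc ‖(mulLp D ω μ (f k) * roeAlgHom D ω hμ ρ (V k) : Lp B p μ →L[ℂ] Lp B p μ)‖
          ≤ ‖(mulLp D ω μ (f k) : Lp B p μ →L[ℂ] Lp B p μ)‖ *
            ‖(roeAlgHom D ω hμ ρ (V k) : Lp B p μ →L[ℂ] Lp B p μ)‖ := norm_mul_le _ _
        _ ≤ ‖f k‖ * 1 := mul_le_mul (norm_mulLp_le D ω μ (f k))
            (norm_roeAlgHom_partialTranslation_le D ω hμ ρ hp (hV k)) (norm_nonneg _)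
            (norm_nonneg _)
        _ = ‖f k‖ := mul_one _

theorem rowSum_sum {X : Type u} [EMetricSpace X] [BoundedGeometry X] {ι : Type*} (s : Finset ι)
    (T : ι → uniformRoe X) : rowSum (∑ k ∈ s, T k) = ∑ k ∈ s, rowSum (T k) := by
  classical
  have hfin : ∀ (T : uniformRoe X) (x : X), (Function.support fun y => entry T.1 x y).Finite := by
    intro T x
    obtain ⟨R, hR⟩ := T.2.2
    obtain ⟨N, hN⟩ := BoundedGeometry.exists_bound (X := X) R
    exact (Set.finite_of_encard_le_coe (hN x)).subset fun y hy => hR x y hy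
  induction s using Finset.induction_on with
  | empty =>
    ext x
    show ∑ᶠ y, entry (0 : Module.End ℂ (X →₀ ℂ)) x y = 0
    simp [entry]
  | insert a s ha ih =>
    rw [Finset.sum_insert ha, Finset.sum_insert ha, ← ih]
    ext x
    exact finsum_add_distrib (hfin (T a) x) (hfin (∑ k ∈ s, T k) x)

/-- The defect of a matrix of propagation at most `R`, in terms of finitely many group
elements. -/
theorem exists_defect_decomposition (D : GeneratingSystem Γ) (ω : Ultrafilter ℕ) (R : ℝ≥0) :
    ∃ (M : ℕ) (g : Fin M → LimitGroup D ω), ∀ {μ : Measure (LimitSpectrum D ω)}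
      (hμ : RepresentsState D ω μ) (hp : p ≠ ∞) (ρ : LimitGroup D ω →* (B ≃ₗᵢ[ℂ] B))
      (V : uniformRoe (SepUnion D)), IsPartialTranslation V → (∀ q ∈ supp V, edist q.1 q.2 ≤ R) →
      ∃ f : Fin M → EllInfty (SepUnion D), (∀ k, ‖f k‖ ≤ 1) ∧
        ∀ ξ : Lp B p μ, (inducedRep D ω hμ hp ρ).defect V ξ =
          ∑ k, mulLp D ω μ (f k) (groupLp D ω hμ ρ (g k) ξ - ξ) := by
  obtain ⟨M, γ, hγ⟩ := exists_decomposition D R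
  refine ⟨M, fun k => QuotientGroup.mk (γ k), fun {μ} hμ hp ρ V hV hR => ?_⟩
  obtain ⟨f, hf, hval, -⟩ := hγ V fun x y h => hR (x, y) h
  refine ⟨f, fun k => norm_le_of_apply_norm_le _ zero_le_one fun x => ?_, fun ξ => ?_⟩
  · rcases hval k x with h | h
    · simp [h]
    · rcases hV.zero_or_one x (rightMul D (γ k).1 x) with h' | h' <;> simp [h, h']
  · have h1 : (roeAlgHom D ω hμ ρ V : Lp B p μ →L[ℂ] Lp B p μ) =
        ∑ k, mulLp D ω μ (f k) * groupLp D ω hμ ρ (QuotientGroup.mk (γ k)) := by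
      rw [hf, map_sum]
      exact Finset.sum_congr rfl fun k _ => roeAlgHom_diag_mul_transOp D ω hμ ρ _ _
    -- The same coefficients sum to `Φ(V)`, so each translation can be paired with its own `-1`.
    have h2 : rowSum V = ∑ k, f k := by
      rw [hf, rowSum_sum]
      exact Finset.sum_congr rfl fun k _ => rowSum_diag_mul_transOp D (γ k) (f k)
    have h3 : (inducedRep D ω hμ hp ρ).defect V = roeAlgHom D ω hμ ρ V -
        roeAlgHom D ω hμ ρ (diag (rowSum V)) := rfl
    rw [h3, roeAlgHom_diag, h1, h2, map_sum, ← Finset.sum_sub_distrib,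
      sum_apply]
    refine Finset.sum_congr rfl fun k _ => ?_
    rw [map_sub]
    rfl

end Contractive

/-! ### Coboundaries modulo invariant vectors -/

section Coboundary

variable {G : Type u} [Group G] {B : Type v} [NormedAddCommGroup B] [NormedSpace ℂ B]

/-- An ergodic argument: summing the translates of `ρ(g)ξ - ξ + η` by `1, g, …, g^(n-1)` telescopes
to `ρ(g^n)ξ - ξ + nη`. The coboundary stays bounded by `2‖ξ‖`, so dividing by `n` leaves only `η` in
the limit. -/
theorem norm_invariant_le_norm_coboundary_add (ρ : G →* (B ≃ₗᵢ[ℂ] B)) (g : G) (ξ : B) {η : B}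
    (hη : η ∈ groupInvariants ρ) : ‖η‖ ≤ ‖ρ g ξ - ξ + η‖ := by
  have hn : ∀ n : ℕ, ‖ρ (g ^ n) ξ - ξ + (n : ℂ) • η‖ ≤ n * ‖ρ g ξ - ξ + η‖ := by
    intro n
    induction n with
    | zero => simp
    | succ n ih =>
      have e : ρ (g ^ (n + 1)) ξ - ξ + ((n + 1 : ℕ) : ℂ) • η =
          ρ g (ρ (g ^ n) ξ - ξ + (n : ℂ) • η) + (ρ g ξ - ξ + η) := by
        have h1 : ρ (g ^ (n + 1)) ξ = ρ g (ρ (g ^ n) ξ) := by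
          rw [pow_succ', map_mul]
          rfl
        rw [h1, map_add, map_sub, map_smul, hη g]
        push_cast
        rw [add_smul, one_smul]
        abel
      rw [e]
      refine (norm_add_le _ _).trans ?_
      rw [LinearIsometryEquiv.norm_map]
      push_cast
      linarith
  by_contra! hlt
  obtain ⟨n, hn'⟩ := exists_nat_gt (2 * ‖ξ‖ / (‖η‖ - ‖ρ g ξ - ξ + η‖))
  rw [div_lt_iff₀ (sub_pos.2 hlt)] at hn'
  have h1 : (n : ℝ) * ‖η‖ ≤ ‖ρ (g ^ n) ξ - ξ + (n : ℂ) • η‖ + ‖ρ (g ^ n) ξ - ξ‖ := by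
    have h2 := norm_sub_le (ρ (g ^ n) ξ - ξ + (n : ℂ) • η) (ρ (g ^ n) ξ - ξ)
    rwa [add_sub_cancel_left, norm_smul, Complex.norm_natCast] at h2
  have h3 : ‖ρ (g ^ n) ξ - ξ‖ ≤ 2 * ‖ξ‖ := by
    refine (norm_sub_le _ _).trans ?_
    rw [LinearIsometryEquiv.norm_map, two_mul]
  have := hn n
  nlinarith

/-- A coboundary is controlled by its class modulo the invariant vectors. -/
theorem norm_apply_sub_le_two_mul_norm_mk (ρ : G →* (B ≃ₗᵢ[ℂ] B)) (g : G) (ξ : B) :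
    ‖ρ g ξ - ξ‖ ≤ 2 * ‖(Submodule.Quotient.mk (ρ g ξ) - Submodule.Quotient.mk ξ :
      B ⧸ groupInvariants ρ)‖ := by
  rw [← Submodule.Quotient.mk_sub]
  refine le_of_forall_pos_le_add fun ε hε => ?_
  -- A nearly minimal representative `m` differs from the coboundary by an invariant vector of norm
  -- at most `‖m‖`, whence the factor `2` and the tolerance `ε / 2`.
  obtain ⟨m, hm, hlt⟩ := Submodule.Quotient.norm_mk_lt
    (Submodule.Quotient.mk (ρ g ξ - ξ) : B ⧸ groupInvariants ρ) (half_pos hε)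
  have hη := (Submodule.Quotient.eq _).1 hm
  have h1 := norm_invariant_le_norm_coboundary_add ρ g ξ hη
  rw [add_sub_cancel] at h1
  have h2 := norm_sub_le m (m - (ρ g ξ - ξ))
  rw [sub_sub_cancel] at h2
  linarith

theorem norm_list_prod_apply_sub_le (ρ : G →* (B ≃ₗᵢ[ℂ] B)) (ξ : B) {δ : ℝ} (L : List G)
    (h : ∀ s ∈ L, ‖ρ s ξ - ξ‖ ≤ δ) : ‖ρ L.prod ξ - ξ‖ ≤ L.length * δ := by
  induction L with
  | nil => simp
  | cons s L ih =>
    have e : ρ (s :: L).prod ξ - ξ = ρ s (ρ L.prod ξ - ξ) + (ρ s ξ - ξ) := by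
      rw [List.prod_cons, map_mul, map_sub]
      exact (sub_add_sub_cancel _ _ _).symm
    rw [e]
    refine (norm_add_le _ _).trans ?_
    rw [LinearIsometryEquiv.norm_map, List.length_cons]
    have h1 := ih fun t ht => h t (by simp [ht])
    have h2 := h s (by simp)
    push_cast
    linarith

end Coboundary

/-! ### Constant functions and the transfer of the spectral gap -/

section Gap

variable {Γ : ℕ → Type u} [∀ n, Group (Γ n)] [∀ n, Fintype (Γ n)]
  {B : Type v} [NormedAddCommGroup B] [NormedSpace ℂ B] {p : ℝ≥0∞} [Fact (1 ≤ p)]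

theorem groupLp_const (D : GeneratingSystem Γ) (ω : Ultrafilter ℕ)
    {μ : Measure (LimitSpectrum D ω)} [IsFiniteMeasure μ] (hμ : RepresentsState D ω μ)
    (ρ : LimitGroup D ω →* (B ≃ₗᵢ[ℂ] B)) (g : LimitGroup D ω) (ξ : B) :
    groupLp D ω hμ ρ g (Lp.const p μ ξ) = Lp.const p μ (ρ g ξ) := by
  induction g using QuotientGroup.induction_on with
  | H γ =>
    refine Lp.ext ?_
    filter_upwards [coeFn_groupLp D ω hμ ρ γ (Lp.const p μ ξ), Lp.coeFn_const p μ (ρ γ ξ),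
      (measurePreserving_spectrumAct D ω hμ γ.1).quasiMeasurePreserving.ae
        (Lp.coeFn_const p μ ξ)] with χ h1 h2 h3
    rw [h1, h2, h3]
    rfl

theorem const_mem_invariants (D : GeneratingSystem Γ) (ω : Ultrafilter ℕ)
    {μ : Measure (LimitSpectrum D ω)} [IsFiniteMeasure μ] (hμ : RepresentsState D ω μ)
    (hp : p ≠ ∞) (ρ : LimitGroup D ω →* (B ≃ₗᵢ[ℂ] B)) {η : B} (hη : η ∈ groupInvariants ρ) :
    Lp.const p μ η ∈ (inducedRep D ω hμ hp ρ).invariants := by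
  intro V hV
  obtain ⟨R, hR⟩ := V.2.2
  obtain ⟨M, g, h⟩ := exists_defect_decomposition (B := B) (p := p) D ω R
  obtain ⟨f, -, hf⟩ := h hμ hp ρ V hV fun q hq => hR q.1 q.2 hq
  rw [← sub_eq_zero]
  refine (hf (Lp.const p μ η)).trans (Finset.sum_eq_zero fun k _ => ?_)
  rw [groupLp_const, hη (g k), sub_self, map_zero]

/-- The full translation `V_γ` is itself a partial translation with `Φ(V_γ) = 1`, so invariance
under it is invariance under the group. -/
theorem groupLp_eq_self_of_mem_invariants (D : GeneratingSystem Γ) (ω : Ultrafilter ℕ)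
    {μ : Measure (LimitSpectrum D ω)} (hμ : RepresentsState D ω μ)
    (hp : p ≠ ∞) (ρ : LimitGroup D ω →* (B ≃ₗᵢ[ℂ] B)) {ξ : Lp B p μ}
    (hξ : ξ ∈ (inducedRep D ω hμ hp ρ).invariants) (γ : boundedSeq D) :
    groupLp D ω hμ ρ (QuotientGroup.mk γ) ξ = ξ := by
  have h := hξ (transOp D γ) (isPartialTranslation_transOp D γ)
  have h1 := roeAlgHom_diag_mul_transOp (B := B) (p := p) D ω hμ ρ 1 γ
  have h2 := rowSum_diag_mul_transOp D γ 1
  rw [diag_one, one_mul] at h1 h2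
  rw [map_one, one_mul] at h1
  rw [h2, diag_one, map_one] at h
  rw [← h1]
  exact h

/-- The map `ρ(g)` commutes with the integral, and `μ` is invariant. Thus the mean of a function
intertwines the two actions of the group. -/
theorem integral_groupLp [CompleteSpace B] (D : GeneratingSystem Γ) (ω : Ultrafilter ℕ)
    {μ : Measure (LimitSpectrum D ω)} (hμ : RepresentsState D ω μ)
    (ρ : LimitGroup D ω →* (B ≃ₗᵢ[ℂ] B)) (γ : boundedSeq D) (ξ : Lp B p μ) :
    ∫ χ, groupLp D ω hμ ρ (QuotientGroup.mk γ) ξ χ ∂μ =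
      ρ (QuotientGroup.mk γ) (∫ χ, ξ χ ∂μ) := by
  rw [integral_congr_ae (coeFn_groupLp D ω hμ ρ γ ξ)]
  have h1 := (ρ (QuotientGroup.mk γ)).toContinuousLinearEquiv.integral_comp_comm (μ := μ)
    fun χ => ξ (spectrumAct D ω γ.1 χ)
  refine h1.trans ?_
  have h2 := (measurePreserving_spectrumAct D ω hμ γ.1).integral_comp
    (spectrumHomeo D ω γ.1).measurableEmbedding (fun χ => ξ χ)
  rw [h2]
  rfl

theorem norm_integral_le_norm_Lp {Y : Type*} [MeasurableSpace Y] {μ : Measure Y}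
    [IsProbabilityMeasure μ] (ξ : Lp B p μ) : ‖∫ χ, ξ χ ∂μ‖ ≤ ‖ξ‖ := by
  refine (norm_integral_le_lintegral_norm _).trans ?_
  rw [Lp.norm_def]
  refine ENNReal.toReal_mono (Lp.eLpNorm_ne_top ξ) ?_
  have h := eLpNorm_le_eLpNorm_of_exponent_le (Fact.out : 1 ≤ p) (Lp.aestronglyMeasurable ξ)
  rw [eLpNorm_one_eq_lintegral_enorm] at h
  simpa only [ofReal_norm] using h

/-- The inclusion of the constant functions is isometric modulo the invariant vectors. -/
theorem norm_mk_const [CompleteSpace B] (D : GeneratingSystem Γ) (ω : Ultrafilter ℕ)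
    {μ : Measure (LimitSpectrum D ω)} [IsProbabilityMeasure μ] (hμ : RepresentsState D ω μ)
    (hp : p ≠ ∞) (ρ : LimitGroup D ω →* (B ≃ₗᵢ[ℂ] B)) (ξ : B) :
    ‖(Submodule.Quotient.mk (Lp.const p μ ξ) : Lp B p μ ⧸ (inducedRep D ω hμ hp ρ).invariants)‖ =
      ‖(Submodule.Quotient.mk ξ : B ⧸ groupInvariants ρ)‖ := by
  have hp0 : p ≠ 0 := (zero_lt_one.trans_le (Fact.out : 1 ≤ p)).ne'
  refine le_antisymm (le_of_forall_pos_le_add fun ε hε => ?_)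
    (le_of_forall_pos_le_add fun ε hε => ?_)
  · obtain ⟨m, hm, hlt⟩ := Submodule.Quotient.norm_mk_lt
      (Submodule.Quotient.mk ξ : B ⧸ groupInvariants ρ) hε
    have h1 := const_mem_invariants (p := p) D ω hμ hp ρ ((Submodule.Quotient.eq _).1 hm)
    rw [map_sub] at h1
    rw [← (Submodule.Quotient.eq _).2 h1]
    refine (Submodule.Quotient.norm_mk_le _ _).trans (le_trans ?_ hlt.le)
    rw [Lp.norm_const' p μ _ hp0 hp]
    simp
  · obtain ⟨m, hm, hlt⟩ := Submodule.Quotient.norm_mk_lt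
      (Submodule.Quotient.mk (Lp.const p μ ξ) :
        Lp B p μ ⧸ (inducedRep D ω hμ hp ρ).invariants) hε
    have h1 := (Submodule.Quotient.eq _).1 hm
    have hint : ∀ ζ : Lp B p μ, Integrable ζ μ := fun ζ =>
      (Lp.memLp ζ).integrable Fact.out
    have h2 : ∫ χ, (m - Lp.const p μ ξ : Lp B p μ) χ ∂μ = ∫ χ, m χ ∂μ - ξ := by
      rw [integral_congr_ae (Lp.coeFn_sub m (Lp.const p μ ξ))]
      simp only [Pi.sub_apply]
      rw [integral_sub (hint _) (hint _), integral_congr_ae (Lp.coeFn_const p μ ξ)]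
      simp
    -- The difference of `m` and the constant `ξ` is fixed by the group, and so is its mean. Hence
    -- the mean of `m` represents `[ξ]`, with norm at most `‖m‖`.
    have h3 : ∫ χ, m χ ∂μ - ξ ∈ groupInvariants ρ := by
      intro g
      induction g using QuotientGroup.induction_on with
      | H γ =>
        rw [← h2, ← integral_groupLp D ω hμ, groupLp_eq_self_of_mem_invariants D ω hμ hp ρ h1]
    rw [← (Submodule.Quotient.eq _).2 h3]
    exact (Submodule.Quotient.norm_mk_le _ _).trans ((norm_integral_le_norm_Lp m).trans hlt.le)

/-- A spectral gap of the induced representation excludes almost invariant vectors, with a constant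
that does not depend on the representation. -/
theorem exists_not_hasAlmostInvariantVector [CompleteSpace B] (D : GeneratingSystem Γ)
    (ω : Ultrafilter ℕ) {μ : Measure (LimitSpectrum D ω)} (hμ : RepresentsState D ω μ)
    (hp : p ≠ ∞) {E₀ : Set (SepUnion D × SepUnion D)} (hE : IsEntourage E₀)
    {S : Set (LimitGroup D ω)} (hS : IsFiniteSymmGenSet S) {c : ℝ} (hc : 0 < c) :
    ∃ ε : ℝ, 0 < ε ∧ ∀ ρ : LimitGroup D ω →* (B ≃ₗᵢ[ℂ] B),
      (inducedRep (p := p) D ω hμ hp ρ).HasSpectralGap E₀ c →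
        ¬ HasAlmostInvariantVector ρ S ε := by
  have := hμ.prob
  have hp0 : p ≠ 0 := (zero_lt_one.trans_le (Fact.out : 1 ≤ p)).ne'
  obtain ⟨R, hR⟩ := hE
  obtain ⟨M, g, hg⟩ := exists_defect_decomposition (B := B) (p := p) D ω R
  choose L hLS hL using fun k => exists_word hS.symm hS.gen (g k)
  -- The total word length over `S` of the group elements attached to `E₀`; it does not involve `ρ`.
  set N : ℝ := ∑ k, ((L k).length : ℝ) with hN
  have hN0 : 0 ≤ N := Finset.sum_nonneg fun k _ => Nat.cast_nonneg _
  -- The defect will be at most `2Nε`, the `2` coming from the passage to the quotient norm. The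
  -- extra `1` keeps the denominator positive and gives the strict `2Nε < c`.
  refine ⟨c / (2 * N + 1), by positivity, ?_⟩
  rintro ρ hgap ⟨ξ, hξ, hinv⟩
  set ε := c / (2 * N + 1) with hε
  obtain ⟨V, hV, hVE, hle⟩ := hgap (Lp.const p μ ξ) (by rw [norm_mk_const, hξ])
  obtain ⟨f, hf1, hf⟩ := hg hμ hp ρ V hV fun q hq => hR q (hVE hq)
  have hS' : ∀ s ∈ S, ‖ρ s ξ - ξ‖ ≤ 2 * ε := fun s hs =>
    (norm_apply_sub_le_two_mul_norm_mk ρ s ξ).trans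
      (mul_le_mul_of_nonneg_left (hinv s hs) zero_le_two)
  have hdefect : ‖(inducedRep D ω hμ hp ρ).defect V (Lp.const p μ ξ)‖ ≤ N * (2 * ε) := by
    rw [hf, hN, Finset.sum_mul]
    refine norm_sum_le_of_le _ fun k _ => ?_
    rw [groupLp_const, ← map_sub]
    calc ‖mulLp D ω μ (f k) (Lp.const p μ (ρ (g k) ξ - ξ))‖
        ≤ 1 * ‖Lp.const p μ (ρ (g k) ξ - ξ)‖ :=
          ContinuousLinearMap.le_of_opNorm_le _ ((norm_mulLp_le D ω μ (f k)).trans (hf1 k)) _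
      _ = ‖ρ (g k) ξ - ξ‖ := by
          rw [one_mul, Lp.norm_const' p μ _ hp0 hp]
          simp
      _ ≤ (L k).length * (2 * ε) := by
          rw [← hL k]
          exact norm_list_prod_apply_sub_le ρ ξ (L k) fun s hs => hS' s (hLS k s hs)
  have h1 := hle.trans ((Submodule.Quotient.norm_mk_le _ _).trans hdefect)
  have h2 : ε * (2 * N + 1) = c := div_mul_cancel₀ _ (by positivity)
  have h3 : 0 < ε := by positivity
  nlinarith

end Gap

end CoarseT

end

/-! ### Conclusion: one constant for each gap, hence both parts -/

theorem proposition5p6 {Γ : ℕ → Type*} [∀ n, Group (Γ n)] [∀ n, Fintype (Γ n)]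
    (D : CoarseT.GeneratingSystem Γ) (ω : Ultrafilter ℕ) (hω : (ω : Filter ℕ) ≤ Filter.cofinite)
    {B : Type*} [NormedAddCommGroup B] [NormedSpace ℂ B] [CompleteSpace B] [UniformConvexSpace B]
    (p : ℝ≥0∞) [Fact (1 ≤ p)] (hp : 1 < p) (hp' : p ≠ ∞) :
    (CoarseT.GeometricT (CoarseT.SepUnion D) (Lp B p (CoarseT.limitMeasure D ω)) →
      CoarseT.PropertyT (CoarseT.LimitGroup D ω) B) ∧
    (CoarseT.UniformGeometricT (CoarseT.SepUnion D) (Lp B p (CoarseT.limitMeasure D ω)) →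
      CoarseT.UniformPropertyT (CoarseT.LimitGroup D ω) B) := by
  have hμ := CoarseT.limitMeasure_representsState D ω
  refine ⟨?_, ?_⟩
  · rintro ⟨E₀, hE, h⟩
    refine ⟨CoarseT.fg_limitGroup D ω, fun S hS ρ => ?_⟩
    obtain ⟨c, hc, hgap⟩ := h (CoarseT.inducedRep D ω hμ hp' ρ)
    obtain ⟨ε, hε, key⟩ := CoarseT.exists_not_hasAlmostInvariantVector (B := B) (p := p) D ω hμ hp'
      hE.isEntourage hS hc
    exact ⟨ε, hε, key ρ hgap⟩
  · rintro ⟨E₀, hE, c, hc, h⟩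
    refine ⟨CoarseT.fg_limitGroup D ω, fun S hS => ?_⟩
    obtain ⟨ε, hε, key⟩ := CoarseT.exists_not_hasAlmostInvariantVector (B := B) (p := p) D ω hμ hp'
      hE.isEntourage hS hc
    exact ⟨ε, hε, fun ρ => key ρ (h _)⟩
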